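/- Let $\Lambda$ be a path-connected compact metric space and $d\ge 0$ an integer; $\mathcal L(\mathbb R^d)$ carries the operator norm of the Euclidean norm. A parametrized linear discrete vector field is a map $\mathbb A\colon\Lambda\times\mathbb Z\to\mathcal L(\mathbb R^d)$ such that the family $\{\mathbb A_n=\mathbb A(\cdot,n)\colon\Lambda\to\mathcal L(\mathbb R^d)\}_{n\in\mathbb Z}$ is equicontinuous and pointwise bounded. It is asymptotically hyperbolic if, as $n\to+\infty$ and as $n\to-\infty$, $\mathbb A_n(\lambda)$ converges uniformly in $\lambda\in\Lambda$ to matrices $\mathcal A_{+}(\lambda)$, respectively $\mathcal A_-(\lambda)$, having no complex eigenvalue of modulus one. For $\gamma_\pm>0$, a vector field $\mathbb D$ is $\gamma_\pm$-small at $\pm\infty$ if there are integers $\kappa_-\le 0\le\kappa_+$ with $\|\mathbb D_n(\lambda)\|\le\gamma_+$ for all $n\ge\kappa_+$ and $\|\mathbb D_n(\lambda)\|\le\gamma_-$ for all $n\le\kappa_-$, for all $\lambda\in\Lambda$. A vector field $\mathbb B$ is said here to have an exponential dichotomy on a discrete half-line $\mathbb I\subset\mathbb Z$ if there are projections $P_n(\lambda)\in\mathcal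 L(\mathbb R^d)$, $n\in\mathbb I$, $\lambda\in\Lambda$, continuous in $\lambda$, such that for each $\lambda$: $\sup_{n\in\mathbb I}\|P_n(\lambda)\|<\infty$; whenever $n,n+1\in\mathbb I$, $P_{n+1}(\lambda)\mathbb B_n(\lambda)=\mathbb B_n(\lambda)P_n(\lambda)$ and $\mathbb B_n(\lambda)$ restricts to an isomorphism $\ker P_n(\lambda)\to\ker P_{n+1}(\lambda)$; and there are $K\ge1$, $\alpha\in(0,1)$ (depending on $\lambda$) such that for all $k\ge n$ in $\mathbb I$ and $x\in\mathbb R^d$, with $\Phi_\lambda(k,n)=\mathbb B_{k-1}(\lambda)\cdots\mathbb B_n(\lambda)$, $$|\Phi_\lambda(k,n)P_n(\lambda)x|\le K\alpha^{k-n}|P_n(\lambda)x|,\qquad |\Phi_\lambda(k,n)(I-P_n(\lambda))x|\ge \tfrac1K\alpha^{-(k-n)}|(I-P_n(\lambda))x|.$$ Call $(\gamma_+,\gamma_-)$ with $\gamma_\pm>0$ admissible for $\mathbb A$ if for every vector field $\mathbb D$ that is $\gamma_\pm$-small at $\pm\infty$ the sum $\mathbb A+\mathbb D$ has an exponential dichotomy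 on $\mathbb Z\cap[\kappa,\infty)$ for some $\kappa\in\mathbb Z$ and on $\mathbb Z\cap(-\infty,\kappa']$ for some $\kappa'\in\mathbb Z$. Let $\ell_0(\mathbb R^d)$ be the Banach space of sequences $\phi\colon\mathbb Z\to\mathbb R^d$ with $\phi(n)\to0$ as $n\to\pm\infty$, with the supremum norm, and let $L_{\mathbb A}(\lambda)\in\mathcal L(\ell_0(\mathbb R^d))$ be given by $(L_{\mathbb A}(\lambda)\phi)(n)=\phi(n+1)-\mathbb A_n(\lambda)\phi(n)$. For a norm-continuous family $L\colon\Lambda\to\mathcal L(X,Y)$ of Fredholm operators between Banach spaces, the index bundle is $\operatorname{ind}(L)=[E(L,V)]-[\Lambda\times V]\in KO(\Lambda)$, where $V\subset Y$ is any finite-dimensional subspace with $\operatorname{im}L(\lambda)+V=Y$ for all $\lambda$ and $E(L,V)$ is the vector bundle with fibres $L(\lambda)^{-1}(V)$ (the class does not depend on $V$); $KO(\Lambda)$ is the Grothendieck group of real vector bundles over $\Lambda$. **Theorem.** Let $\mathbb A$ be asymptotically hyperbolic. Then admissible pairs $(\gamma_+,\gamma_-)$ for $\mathbb A$ exist, and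 for every admissible pair and every vector field $\mathbb D$ that is $\gamma_\pm$-small at $\pm\infty$, the maps $L_{\mathbb A+\mathbb D}$ and $L_{\mathbb A}$ from $\Lambda$ to $\mathcal L(\ell_0(\mathbb R^d))$ are continuous families of Fredholm operators, and $$\operatorname{ind}(L_{\mathbb A+\mathbb D})=\operatorname{ind}(L_{\mathbb A})\in KO(\Lambda).$$ -/

import Mathlib

noncomputable section

universe u

open Bundle Topology

/-- Real vector bundles of finite (constant) rank over `Λ`, bundled from Mathlib's vector bundles.
Over a connected base every vector bundle of finite rank has constant rank. -/
structure RealVectorBundle (Λ : Type u) [TopologicalSpace Λ] where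
  Model : Type
  Fib : Λ → Type
  [normedModel : NormedAddCommGroup Model]
  [spaceModel : NormedSpace ℝ Model]
  [finiteModel : FiniteDimensional ℝ Model]
  [addFib : ∀ l, AddCommMonoid (Fib l)]
  [moduleFib : ∀ l, Module ℝ (Fib l)]
  [topFib : ∀ l, TopologicalSpace (Fib l)]
  [topTotal : TopologicalSpace (TotalSpace Model Fib)]
  [fiberBundle : FiberBundle Model Fib]
  [vectorBundle : VectorBundle ℝ Model Fib]

namespace RealVectorBundle

attribute [instance] normedModel spaceModel finiteModel addFib moduleFib topFib topTotal
  fiberBundle vectorBundle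

variable {Λ : Type u} [TopologicalSpace Λ]

/-- The total space. -/
abbrev Total (E : RealVectorBundle Λ) : Type u := TotalSpace E.Model E.Fib

/-- Isomorphisms of vector bundles over `Λ`: fibrewise linear homeomorphisms of the total spaces. -/
structure Iso (E E' : RealVectorBundle Λ) where
  fib : ∀ l, E.Fib l ≃ₗ[ℝ] E'.Fib l
  continuous_toFun : Continuous fun p : E.Total => (⟨p.1, fib p.1 p.2⟩ : E'.Total)
  continuous_invFun : Continuous fun p : E'.Total => (⟨p.1, (fib p.1).symm p.2⟩ : E.Total)

def Iso.refl (E : RealVectorBundle Λ) : Iso E E where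
  fib _ := LinearEquiv.refl ℝ _
  continuous_toFun := continuous_id
  continuous_invFun := continuous_id

def Iso.symm {E E' : RealVectorBundle Λ} (e : Iso E E') : Iso E' E where
  fib l := (e.fib l).symm
  continuous_toFun := e.continuous_invFun
  continuous_invFun := e.continuous_toFun

def Iso.trans {E E' E'' : RealVectorBundle Λ} (e : Iso E E') (e' : Iso E' E'') : Iso E E'' where
  fib l := (e.fib l).trans (e'.fib l)
  continuous_toFun := e'.continuous_toFun.comp e.continuous_toFun
  continuous_invFun := e.continuous_invFun.comp e'.continuous_invFun

instance isoSetoid (Λ : Type u) [TopologicalSpace Λ] : Setoid (RealVectorBundle Λ) where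
  r E E' := Nonempty (Iso E E')
  iseqv := ⟨fun E => ⟨Iso.refl E⟩, fun ⟨e⟩ => ⟨e.symm⟩, fun ⟨e⟩ ⟨e'⟩ => ⟨e.trans e'⟩⟩

/-- The Whitney sum of two vector bundles. -/
def sum (E E' : RealVectorBundle Λ) : RealVectorBundle Λ where
  Model := E.Model × E'.Model
  Fib := E.Fib ×ᵇ E'.Fib

/-- The product bundle with fibre `V`. -/
def trivial (Λ : Type u) [TopologicalSpace Λ] (V : Type) [NormedAddCommGroup V] [NormedSpace ℝ V]
    [FiniteDimensional ℝ V] : RealVectorBundle Λ where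
  Model := V
  Fib := Bundle.Trivial Λ V

section sum
variable {A B C D : RealVectorBundle Λ}

theorem continuous_fst : Continuous fun p : (sum A B).Total => (⟨p.1, p.2.1⟩ : A.Total) :=
  (FiberBundle.Prod.isInducing_diag A.Model A.Fib B.Model B.Fib).continuous.fst

theorem continuous_snd : Continuous fun p : (sum A B).Total => (⟨p.1, p.2.2⟩ : B.Total) :=
  (FiberBundle.Prod.isInducing_diag A.Model A.Fib B.Model B.Fib).continuous.snd

theorem continuous_pair {Z : Type*} [TopologicalSpace Z] {f : Z → (sum A B).Total}
    (h : Continuous fun z => (⟨(f z).1, (f z).2.1⟩ : A.Total))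
    (h' : Continuous fun z => (⟨(f z).1, (f z).2.2⟩ : B.Total)) : Continuous f :=
  (FiberBundle.Prod.isInducing_diag A.Model A.Fib B.Model B.Fib).continuous_iff.2 (h.prodMk h')

def sumCongr (e : Iso A B) (e' : Iso C D) : Iso (sum A C) (sum B D) where
  fib l := (e.fib l).prodCongr (e'.fib l)
  continuous_toFun := continuous_pair (e.continuous_toFun.comp continuous_fst)
    (e'.continuous_toFun.comp continuous_snd)
  continuous_invFun := continuous_pair (e.continuous_invFun.comp continuous_fst)
    (e'.continuous_invFun.comp continuous_snd)

def sumComm (A B : RealVectorBundle Λ) : Iso (sum A B) (sum B A) where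
  fib _ := LinearEquiv.prodComm ℝ _ _
  continuous_toFun := continuous_pair continuous_snd continuous_fst
  continuous_invFun := continuous_pair continuous_snd continuous_fst

def sumAssoc (A B C : RealVectorBundle Λ) : Iso (sum (sum A B) C) (sum A (sum B C)) where
  fib _ := LinearEquiv.prodAssoc ℝ _ _ _
  continuous_toFun := by
    have h : Continuous fun p : (sum (sum A B) C).Total => (⟨p.1, p.2.1.1⟩ : A.Total) :=
      (continuous_fst (A := A) (B := B)).comp (continuous_fst (A := sum A B) (B := C))
    exact continuous_pair h (continuous_pair (continuous_snd.comp continuous_fst) continuous_snd)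
  continuous_invFun := by
    have h : Continuous fun p : (sum A (sum B C)).Total => (⟨p.1, p.2.2.2⟩ : C.Total) :=
      (continuous_snd (A := B) (B := C)).comp (continuous_snd (A := A) (B := sum B C))
    exact continuous_pair (continuous_pair continuous_fst (continuous_fst.comp continuous_snd)) h

theorem continuous_trivial {V : Type} [NormedAddCommGroup V] [NormedSpace ℝ V]
    [FiniteDimensional ℝ V] {Z : Type*} [TopologicalSpace Z] {b : Z → Λ} {f : Z → V} :
    Continuous (fun z => (⟨b z, f z⟩ : (trivial Λ V).Total)) ↔ Continuous b ∧ Continuous f :=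
  ((Bundle.Trivial.homeomorphProd Λ V).isInducing.continuous_iff).trans
    ⟨fun h => ⟨h.fst, h.snd⟩, fun h => h.1.prodMk h.2⟩

theorem continuous_proj (A : RealVectorBundle Λ) : Continuous fun p : A.Total => p.1 :=
  FiberBundle.continuous_proj A.Model A.Fib

def sumZero (A : RealVectorBundle Λ) : Iso (sum A (trivial Λ PUnit)) A where
  fib l := LinearEquiv.prodUnique (M₂ := Bundle.Trivial Λ PUnit l)
  continuous_toFun := continuous_fst
  continuous_invFun := by
    have h : Continuous fun p : A.Total => (⟨p.1, PUnit.unit⟩ : (trivial Λ PUnit).Total) :=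
      continuous_trivial.2 ⟨continuous_proj A, continuous_const⟩
    exact continuous_pair continuous_id h

end sum

/-- Isomorphism classes of real vector bundles over `Λ`, a commutative monoid under Whitney sum. -/
def IsoClass (Λ : Type u) [TopologicalSpace Λ] : Type (max u 1) := Quotient (isoSetoid Λ)

/-- The isomorphism class of a vector bundle. -/
def cls (E : RealVectorBundle Λ) : IsoClass Λ := Quotient.mk _ E

instance : Add (IsoClass Λ) :=
  ⟨Quotient.map₂ sum fun _ _ ⟨e⟩ _ _ ⟨e'⟩ => ⟨sumCongr e e'⟩⟩

instance : Zero (IsoClass Λ) := ⟨Quotient.mk _ (trivial Λ PUnit)⟩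

instance : AddCommMonoid (IsoClass Λ) where
  add_assoc := by rintro ⟨a⟩ ⟨b⟩ ⟨c⟩; exact Quotient.sound ⟨sumAssoc a b c⟩
  add_comm := by rintro ⟨a⟩ ⟨b⟩; exact Quotient.sound ⟨sumComm a b⟩
  zero_add := by rintro ⟨a⟩; exact Quotient.sound ⟨(sumComm _ _).trans (sumZero a)⟩
  add_zero := by rintro ⟨a⟩; exact Quotient.sound ⟨sumZero a⟩
  nsmul := nsmulRec

theorem cls_eq {A B : RealVectorBundle Λ} (e : Iso A B) : cls A = cls B := Quotient.sound ⟨e⟩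

theorem cls_sum (A B : RealVectorBundle Λ) : cls (sum A B) = cls A + cls B := rfl

end RealVectorBundle

/-- The group `KO(Λ)`: the Grothendieck group of the monoid of isomorphism classes of real vector
bundles over `Λ`. -/
abbrev KO (Λ : Type u) [TopologicalSpace Λ] : Type (max u 1) :=
  Algebra.GrothendieckAddGroup (RealVectorBundle.IsoClass Λ)
/-- The class `[E]` in `KO(Λ)`. -/
def KO.of {Λ : Type u} [TopologicalSpace Λ] (E : RealVectorBundle Λ) : KO Λ :=
  Algebra.GrothendieckAddGroup.of E.cls

section Subbundle

variable {Λ : Type u} [TopologicalSpace Λ] {X : Type} [NormedAddCommGroup X] [NormedSpace ℝ X]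

/-- The topology of the total space `{(l, x) | x ∈ K l}` as a subspace of `Λ × X`. -/
abbrev subTop (F : Type) (K : Λ → Submodule ℝ X) :
    TopologicalSpace (TotalSpace F fun l => K l) :=
  TopologicalSpace.induced (fun p => (p.1, (p.2 : X))) inferInstance

attribute [local instance] subTop

theorem subTop_isInducing (F : Type) (K : Λ → Submodule ℝ X) :
    IsInducing fun p : TotalSpace F fun l => K l => (p.1, (p.2 : X)) := ⟨rfl⟩

variable {F : Type} [NormedAddCommGroup F] [NormedSpace ℝ F] {K : Λ → Submodule ℝ X}

/-- A trivialization which is the restriction of a linear map `X → F`, with inverses depending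
continuously on the base point in operator norm. -/
def IsGoodTriv (e : Trivialization F (π F fun l => K l)) : Prop :=
  ∃ (Q : X →L[ℝ] F) (R : Λ → F →L[ℝ] X), ContinuousOn R e.baseSet ∧
    (∀ l ∈ e.baseSet, ∀ x : K l, e ⟨l, x⟩ = (l, Q x)) ∧
    ∀ l ∈ e.baseSet, ∀ v, ((e.symm l v : K l) : X) = R l v

/-- Local frames give a trivialization. -/
theorem exists_goodTriv (l₀ : Λ) (U : Set Λ) (hU : IsOpen U) (hl₀ : l₀ ∈ U) (Q : X →L[ℝ] F)
    (R : Λ → F →L[ℝ] X) (hR : ContinuousOn R U) (hK : ∀ l ∈ U, ∀ v, R l v ∈ K l)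
    (hQR : ∀ l ∈ U, ∀ v, Q (R l v) = v) (hRQ : ∀ l ∈ U, ∀ x ∈ K l, R l (Q x) = x) :
    ∃ e : Trivialization F (π F fun l => K l), l₀ ∈ e.baseSet ∧ IsGoodTriv e := by
  classical
  have hproj : Continuous fun p : TotalSpace F fun l => K l => p.1 :=
    (subTop_isInducing F K).continuous.fst
  have hval : Continuous fun p : TotalSpace F fun l => K l => (p.2 : X) :=
    (subTop_isInducing F K).continuous.snd
  let inv : Λ × F → TotalSpace F fun l => K l :=
    fun q => if h : q.1 ∈ U then ⟨q.1, ⟨R q.1 q.2, hK _ h _⟩⟩ else ⟨q.1, 0⟩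
  have hinv : ∀ l (hl : l ∈ U) v, inv (l, v) = ⟨l, ⟨R l v, hK l hl v⟩⟩ :=
    fun l hl v => dif_pos hl
  let e : Trivialization F (π F fun l => K l) :=
    { toFun := fun p => (p.1, Q p.2)
      invFun := inv
      source := π F (fun l => K l) ⁻¹' U
      target := U ×ˢ Set.univ
      map_source' := fun p hp => ⟨hp, trivial⟩
      map_target' := by
        rintro ⟨l, v⟩ ⟨hl, -⟩
        rw [hinv l hl v]
        exact hl
      left_inv' := by
        rintro ⟨l, x⟩ hl
        have hl' : l ∈ U := hl
        rw [hinv l hl']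
        congr 1
        exact Subtype.ext (hRQ l hl' x x.2)
      right_inv' := by
        rintro ⟨l, v⟩ ⟨hl, -⟩
        have hl' : l ∈ U := hl
        rw [hinv l hl' v]
        simp only [hQR l hl' v]
      open_source := hU.preimage hproj
      open_target := hU.prod isOpen_univ
      continuousOn_toFun := (hproj.prodMk (Q.continuous.comp hval)).continuousOn
      continuousOn_invFun := by
        rw [(subTop_isInducing F K).continuousOn_iff]
        have h1 : ContinuousOn (fun q : Λ × F => (q.1, R q.1 q.2)) (U ×ˢ Set.univ) := by
          refine continuous_fst.continuousOn.prodMk ?_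
          exact (hR.comp continuous_fst.continuousOn fun q hq => hq.1).clm_apply
            continuous_snd.continuousOn
        refine h1.congr ?_
        rintro ⟨l, v⟩ ⟨hl, -⟩
        have hl' : l ∈ U := hl
        exact congrArg (fun p : TotalSpace F fun l => K l => (p.1, (p.2 : X))) (hinv l hl' v)
      baseSet := U
      open_baseSet := hU
      source_eq := rfl
      target_eq := rfl
      proj_toFun := fun p _ => rfl }
  refine ⟨e, hl₀, Q, R, hR, fun l _ x => rfl, fun l hl v => ?_⟩
  have hl' : l ∈ U := hl
  have h := e.mk_symm hl v
  have h2 : e.toOpenPartialHomeomorph.symm (l, v) = ⟨l, ⟨R l v, hK l hl' v⟩⟩ := hinv l hl' v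
  rw [h2] at h
  have h3 := congrArg (fun p : TotalSpace F fun l => K l => (p.2 : X)) h
  exact h3

theorem IsGoodTriv.isLinear {e : Trivialization F (π F fun l => K l)} (he : IsGoodTriv e) :
    e.IsLinear ℝ := by
  obtain ⟨Q, R, -, hQ, -⟩ := he
  refine ⟨fun l hl => ⟨fun x y => ?_, fun c x => ?_⟩⟩
  · simp only [hQ l hl, Submodule.coe_add, map_add]
  · simp only [hQ l hl, Submodule.coe_smul, map_smul]

theorem IsGoodTriv.continuousOn_coordChange {e e' : Trivialization F (π F fun l => K l)}
    (he : IsGoodTriv e) (he' : IsGoodTriv e') [e.IsLinear ℝ] [e'.IsLinear ℝ] :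
    ContinuousOn (fun l => (Trivialization.coordChangeL ℝ e e' l : F →L[ℝ] F))
      (e.baseSet ∩ e'.baseSet) := by
  obtain ⟨Q, R, hR, -, hR'⟩ := he
  obtain ⟨Q', R', -, hQ', -⟩ := he'
  have h : ContinuousOn (fun l => Q'.comp (R l)) (e.baseSet ∩ e'.baseSet) :=
    (continuousOn_const.clm_comp (hR.mono Set.inter_subset_left))
  refine h.congr fun l hl => ?_
  ext v
  rw [ContinuousLinearEquiv.coe_coe, Trivialization.coordChangeL_apply e e' hl, hQ' l hl.2,
    hR' l hl.1]
  rfl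

end Subbundle

/-- The images of a continuous family of projections of finite rank have local frames. -/
theorem exists_localFrame {Λ : Type u} [TopologicalSpace Λ] [PreconnectedSpace Λ] {X : Type}
    [NormedAddCommGroup X] [NormedSpace ℝ X] [CompleteSpace X]
    (K : Λ → Submodule ℝ X) [∀ l, FiniteDimensional ℝ (K l)]
    (p : Λ → X →L[ℝ] X) (hp : Continuous p) (hpK : ∀ l x, p l x ∈ K l)
    (hpx : ∀ l, ∀ x ∈ K l, p l x = x) (l₀ l₁ : Λ) :
    ∃ (U : Set Λ) (Q : X →L[ℝ] K l₁) (R : Λ → K l₁ →L[ℝ] X), IsOpen U ∧ l₀ ∈ U ∧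
      ContinuousOn R U ∧ (∀ l ∈ U, ∀ v, R l v ∈ K l) ∧
      (∀ l ∈ U, ∀ v, Q (R l v) = v) ∧ (∀ l ∈ U, ∀ x ∈ K l, R l (Q x) = x) := by
  -- the local statement with model `K l₀`
  have key : ∀ l₀ : Λ, ∃ (U : Set Λ) (Q : X →L[ℝ] K l₀) (R : Λ → K l₀ →L[ℝ] X), IsOpen U ∧ l₀ ∈ U ∧
      ContinuousOn R U ∧ (∀ l ∈ U, ∀ v, R l v ∈ K l) ∧
      (∀ l ∈ U, ∀ v, Q (R l v) = v) ∧ (∀ l ∈ U, ∀ x ∈ K l, R l (Q x) = x) := by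
    intro l₀
    let Q : X →L[ℝ] K l₀ := (p l₀).codRestrict (K l₀) (hpK l₀)
    let G : Λ → K l₀ →L[ℝ] K l₀ := fun l => Q.comp ((p l).comp (K l₀).subtypeL)
    have hG : Continuous G := by fun_prop
    have hG0 : G l₀ = ContinuousLinearMap.id ℝ (K l₀) := by
      ext x
      simp [G, Q, hpx l₀ x x.2]
    let U₁ : Set Λ := {l | G l ∈ Set.range ((↑) : (K l₀ ≃L[ℝ] K l₀) → (K l₀ →L[ℝ] K l₀))}
    let U₂ : Set Λ := {l | ‖p l - p l₀‖ < 1}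
    have hU₁ : IsOpen U₁ := (ContinuousLinearEquiv.isOpen).preimage hG
    have hU₂ : IsOpen U₂ := isOpen_lt (by fun_prop) continuous_const
    have hinv : ContinuousOn (fun l => (G l).inverse) U₁ := by
      rintro l ⟨e, he⟩
      refine ContinuousAt.continuousWithinAt ?_
      have h := (contDiffAt_map_inverse (𝕜 := ℝ) (n := 0) e).continuousAt
      rw [he] at h
      exact ContinuousAt.comp (f := G) h hG.continuousAt
    have hGi : ∀ l ∈ U₁, ∀ v, G l ((G l).inverse v) = v := by
      rintro l ⟨e, he⟩ v
      rw [← he]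
      simp
    refine ⟨U₁ ∩ U₂, Q, fun l => ((p l).comp (K l₀).subtypeL).comp (G l).inverse,
      hU₁.inter hU₂, ⟨⟨ContinuousLinearEquiv.refl ℝ _, by rw [hG0]; rfl⟩, by simp [U₂]⟩,
      ?_, ?_, ?_, ?_⟩
    · have h1 : Continuous fun l => (p l).comp (K l₀).subtypeL := by fun_prop
      exact h1.continuousOn.clm_comp (hinv.mono Set.inter_subset_left)
    · intro l hl v
      exact hpK _ _
    · intro l hl v
      exact hGi l hl.1 v
    · intro l hl x hx
      have hinj : ∀ y ∈ K l, Q y = 0 → y = 0 := by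
        intro y hy hQ
        by_contra hne
        have h0 : p l₀ y = 0 := congrArg Subtype.val hQ
        have h1 : (p l - p l₀) y = y := by simp [h0, hpx l y hy]
        have h2 := (p l - p l₀).le_opNorm y
        rw [h1] at h2
        have h3 : ‖p l - p l₀‖ < 1 := hl.2
        nlinarith [norm_pos_iff.2 hne]
      refine sub_eq_zero.1 (hinj _ ((K l).sub_mem (hpK _ _) hx) ?_)
      rw [map_sub, sub_eq_zero]
      exact hGi l hl.1 (Q x)
  -- the rank is locally constant, hence constant
  have hrank : IsLocallyConstant fun l => Module.finrank ℝ (K l) := by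
    rw [IsLocallyConstant.iff_exists_open]
    intro l₀
    obtain ⟨U, Q, R, hU, h0, -, hK, hQR, hRQ⟩ := key l₀
    refine ⟨U, hU, h0, fun l hl => LinearEquiv.finrank_eq ?_⟩
    exact
      { toFun := fun x => Q x
        map_add' := fun x y => by simp
        map_smul' := fun c x => by simp
        invFun := fun v => ⟨R l v, hK l hl v⟩
        left_inv := fun x => Subtype.ext (hRQ l hl x x.2)
        right_inv := fun v => hQR l hl v }
  obtain ⟨e⟩ := FiniteDimensional.nonempty_continuousLinearEquiv_of_finrank_eq (𝕜 := ℝ)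
    (hrank.apply_eq_of_preconnectedSpace l₀ l₁)
  obtain ⟨U, Q, R, hU, h0, hR, hK, hQR, hRQ⟩ := key l₀
  refine ⟨U, (e : K l₀ →L[ℝ] K l₁).comp Q, fun l => (R l).comp (e.symm : K l₁ →L[ℝ] K l₀),
    hU, h0, hR.clm_comp continuousOn_const, fun l hl v => hK l hl _, fun l hl v => ?_,
    fun l hl x hx => ?_⟩
  · simp [hQR l hl]
  · simp [hRQ l hl x hx]

section subbundle

attribute [local instance] subTop

/-- The vector bundle `{(l, x) | x ∈ K l} ⊆ Λ × X`, for a family `K l` of finite-dimensional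
subspaces of `X` which are the images of a continuous family of projections. -/
def subbundle {Λ : Type u} [TopologicalSpace Λ] [ConnectedSpace Λ] {X : Type}
    [NormedAddCommGroup X] [NormedSpace ℝ X] [CompleteSpace X]
    (K : Λ → Submodule ℝ X) (hfin : ∀ l, FiniteDimensional ℝ (K l))
    (hproj : ∃ p : Λ → X →L[ℝ] X, Continuous p ∧ (∀ l x, p l x ∈ K l) ∧
      ∀ l, ∀ x ∈ K l, p l x = x) : RealVectorBundle Λ :=
  have htriv : ∀ l : Λ, ∃ e : Trivialization (K (Classical.arbitrary Λ))
      (π (K (Classical.arbitrary Λ)) fun l => K l), l ∈ e.baseSet ∧ IsGoodTriv e := by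
    intro l
    obtain ⟨p, hp, hpK, hpx⟩ := hproj
    obtain ⟨U, Q, R, hU, h0, hR, hK, hQR, hRQ⟩ :=
      exists_localFrame K p hp hpK hpx l (Classical.arbitrary Λ)
    exact exists_goodTriv l U hU h0 Q R hR hK hQR hRQ
  letI top : TopologicalSpace (TotalSpace (K (Classical.arbitrary Λ)) fun l => K l) :=
    subTop (K (Classical.arbitrary Λ)) K
  letI fb : FiberBundle (K (Classical.arbitrary Λ)) fun l => K l :=
    { totalSpaceMk_isInducing' := fun l => by
        rw [← (subTop_isInducing _ K).of_comp_iff]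
        exact (isInducing_const_prod (x := l)).2 IsInducing.subtypeVal
      trivializationAtlas' := {e | IsGoodTriv e}
      trivializationAt' := fun l => (htriv l).choose
      mem_baseSet_trivializationAt' := fun l => (htriv l).choose_spec.1
      trivialization_mem_atlas' := fun l => (htriv l).choose_spec.2 }
  { Model := K (Classical.arbitrary Λ)
    Fib := fun l => K l
    vectorBundle :=
      { trivialization_linear' := fun e he => IsGoodTriv.isLinear he.out
        continuousOn_coordChange' := fun e e' he he' =>
          haveI := IsGoodTriv.isLinear he.out
          haveI := IsGoodTriv.isLinear he'.out
          IsGoodTriv.continuousOn_coordChange he.out he'.out } }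

end subbundle

section index

variable {Λ : Type u} [TopologicalSpace Λ] {X Y : Type}
  [NormedAddCommGroup X] [NormedSpace ℝ X] [NormedAddCommGroup Y] [NormedSpace ℝ Y]

/-- A norm-continuous family of Fredholm operators. -/
structure IsFredholmFamily (L : Λ → X →L[ℝ] Y) : Prop where
  continuous : Continuous L
  isFredholm : ∀ l, (L l).IsFredholm

/-- `V` is finite-dimensional and `im (L l) + V = Y` for all `l`. -/
structure IsTransversal (L : Λ → X →L[ℝ] Y) (V : Submodule ℝ Y) : Prop where
  finite : FiniteDimensional ℝ V
  sup_eq_top : ∀ l, (L l).range ⊔ V = ⊤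

theorem exists_rightInv {T : X →L[ℝ] Y} (hT : T.IsFredholm) {V : Submodule ℝ Y}
    (_ : FiniteDimensional ℝ V) (hTV : T.range ⊔ V = ⊤) :
    ∃ R : Y →L[ℝ] X × V, ∀ y, T (R y).1 + (R y).2 = y := by
  have hB : Function.Surjective (LinearMap.coprod T.toLinearMap V.subtype) := by
    rw [← LinearMap.range_eq_top, LinearMap.range_coprod, Submodule.range_subtype]
    exact hTV
  obtain ⟨g, hg⟩ := LinearMap.exists_rightInverse_of_surjective _ (LinearMap.range_eq_top.2 hB)
  have hg' : ∀ y, T (g y).1 + (g y).2 = y := fun y => congrArg (fun f => f y) hg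
  obtain ⟨C, hC⟩ := hT.closedComplemented_range.exists_isTopCompl
  obtain ⟨D, hD⟩ := hT.closedComplemented_ker.exists_isTopCompl
  let pkg := hT.fredholmPackage hD hC
  have hfin : FiniteDimensional ℝ pkg.decCodom.X₀ := pkg.decCodom.finite_X₀
  let q : Y →L[ℝ] pkg.decCodom.X₀ :=
    pkg.decCodom.X₀.projectionOntoL pkg.decCodom.X₁ pkg.decCodom.isTopCompl.symm
  let g₀ : pkg.decCodom.X₀ →L[ℝ] X × V :=
    LinearMap.toContinuousLinearMap (g.comp pkg.decCodom.X₀.subtype)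
  refine ⟨(ContinuousLinearMap.inl ℝ X V).comp pkg.quasiInverse + g₀.comp q, fun y => ?_⟩
  have h1 : T (pkg.quasiInverse y) + (q y : Y) = y := by
    have e1 : ∀ x, T x = pkg.equiv (pkg.decDom.proj x) := fun x =>
      congrArg (fun f => f x) pkg.eq_equiv
    have e2 : pkg.quasiInverse y = (pkg.equiv.symm (pkg.decCodom.proj y) : X) := rfl
    rw [e1, e2, Submodule.projectionOntoL_apply_left, ContinuousLinearEquiv.apply_symm_apply]
    exact Submodule.projection_add_projection_eq_self pkg.decCodom.isTopCompl.isCompl y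
  have h2 := hg' (q y : Y)
  calc _ = T (pkg.quasiInverse y) + (T (g (q y : Y)).1 + ((g (q y : Y)).2 : Y)) := by
        simp [g₀]; abel
    _ = y := by rw [h2, h1]

/-- Solving `L l x ≡ y` modulo `V` locally, continuously in `l`. -/
theorem exists_local_parametrix [CompleteSpace Y] {L : Λ → X →L[ℝ] Y} (hL : IsFredholmFamily L) (l₀ : Λ)
    {V : Submodule ℝ Y} (hV : FiniteDimensional ℝ V) (hLV : (L l₀).range ⊔ V = ⊤) :
    ∃ (U : Set Λ) (s : Λ → Y →L[ℝ] X), IsOpen U ∧ l₀ ∈ U ∧ ContinuousOn s U ∧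
      ∀ l ∈ U, ∀ y, L l (s l y) - y ∈ V := by
  obtain ⟨R, hR⟩ := exists_rightInv (hL.isFredholm l₀) hV hLV
  let G : Λ → Y →L[ℝ] Y := fun l => (L l).comp ((ContinuousLinearMap.fst ℝ X V).comp R) +
    V.subtypeL.comp ((ContinuousLinearMap.snd ℝ X V).comp R)
  have hG : Continuous G := by
    have := hL.continuous
    fun_prop
  have hG0 : G l₀ = ContinuousLinearMap.id ℝ Y := by
    ext y
    exact hR y
  let U : Set Λ := {l | G l ∈ Set.range ((↑) : (Y ≃L[ℝ] Y) → (Y →L[ℝ] Y))}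
  have hU : IsOpen U := (ContinuousLinearEquiv.isOpen).preimage hG
  have hinv : ContinuousOn (fun l => (G l).inverse) U := by
    rintro l ⟨e, he⟩
    refine ContinuousAt.continuousWithinAt ?_
    have h := (contDiffAt_map_inverse (𝕜 := ℝ) (n := 0) e).continuousAt
    rw [he] at h
    exact ContinuousAt.comp (f := G) h hG.continuousAt
  refine ⟨U, fun l => ((ContinuousLinearMap.fst ℝ X V).comp R).comp (G l).inverse, hU,
    ⟨ContinuousLinearEquiv.refl ℝ _, by rw [hG0]; rfl⟩, continuousOn_const.clm_comp hinv, ?_⟩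
  rintro l ⟨e, he⟩ y
  have h1 : G l ((G l).inverse y) = y := by
    rw [← he]
    simp
  have h2 : L l (R ((G l).inverse y)).1 + ((R ((G l).inverse y)).2 : Y) = y := h1
  have h3 : L l (R ((G l).inverse y)).1 - y = -((R ((G l).inverse y)).2 : Y) := by
    rw [eq_neg_iff_add_eq_zero, sub_add_eq_add_sub, h2, sub_self]
  change L l (R ((G l).inverse y)).1 - y ∈ V
  rw [h3]
  exact V.neg_mem (Submodule.coe_mem _)

/-- Over a compact base there is a subspace transversal to a given family. -/
theorem exists_isTransversal [CompactSpace Λ] [CompleteSpace Y] {L : Λ → X →L[ℝ] Y}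
    (hL : IsFredholmFamily L) : ∃ V : Submodule ℝ Y, IsTransversal L V := by
  have h : ∀ l₀ : Λ, ∃ (V : Submodule ℝ Y) (U : Set Λ), FiniteDimensional ℝ V ∧ IsOpen U ∧ l₀ ∈ U ∧
      ∀ l ∈ U, (L l).range ⊔ V = ⊤ := by
    intro l₀
    obtain ⟨V, hV⟩ := (L l₀).range.exists_isCompl
    have hfin : FiniteDimensional ℝ V :=
      .of_fg ((hL.isFredholm l₀).finite_coker.fg_of_isCompl hV)
    obtain ⟨U, s, hU, h0, -, hs⟩ := exists_local_parametrix hL l₀ hfin hV.sup_eq_top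
    refine ⟨V, U, hfin, hU, h0, fun l hl => eq_top_iff.2 fun y _ => ?_⟩
    have h1 := Submodule.add_mem_sup (LinearMap.mem_range_self (L l).toLinearMap (s l y))
      (V.neg_mem (hs l hl y))
    simpa using h1
  choose V U hfin hU h0 hV using h
  obtain ⟨t, ht⟩ := CompactSpace.elim_nhds_subcover U fun l => (hU l).mem_nhds (h0 l)
  refine ⟨t.sup V, Submodule.finiteDimensional_finset_sup t V, fun l => ?_⟩
  have hl : l ∈ ⋃ x ∈ t, U x := ht ▸ Set.mem_univ l
  simp only [Set.mem_iUnion] at hl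
  obtain ⟨x, hx, hlx⟩ := hl
  exact eq_top_iff.2 ((hV x l hlx).ge.trans (sup_le_sup_left (Finset.le_sup hx) _))

/-- Solving `L l x ≡ y` modulo `V` globally, continuously in `l`. -/
theorem exists_parametrix [CompactSpace Λ] [T2Space Λ] [CompleteSpace Y] {L : Λ → X →L[ℝ] Y}
    (hL : IsFredholmFamily L) {V : Submodule ℝ Y} (hV : IsTransversal L V) :
    ∃ s : Λ → Y →L[ℝ] X, Continuous s ∧ ∀ l y, L l (s l y) - y ∈ V := by
  have hconv : ∀ l, Convex ℝ {s : Y →L[ℝ] X | ∀ y, L l (s y) - y ∈ V} := by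
    intro l s hs s' hs' a b _ _ hab y
    have h : L l ((a • s + b • s') y) - y = a • (L l (s y) - y) + b • (L l (s' y) - y) := by
      have h1 : y = a • y + b • y := by rw [← add_smul, hab, one_smul]
      have h2 : L l ((a • s + b • s') y) = a • L l (s y) + b • L l (s' y) := by simp
      rw [h2, smul_sub, smul_sub, sub_add_sub_comm, ← h1]
    rw [h]
    exact V.add_mem (V.smul_mem _ (hs y)) (V.smul_mem _ (hs' y))
  obtain ⟨s, hs⟩ := exists_continuous_forall_mem_convex_of_local hconv fun l₀ => by
    obtain ⟨U, s, hU, h0, hs, hsV⟩ :=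
      exists_local_parametrix hL l₀ hV.finite (hV.sup_eq_top l₀)
    exact ⟨U, hU.mem_nhds h0, s, hs, hsV⟩
  exact ⟨s, s.continuous, hs⟩

theorem IsTransversal.exists_proj {L : Λ → X →L[ℝ] Y} {V : Submodule ℝ Y}
    (hV : IsTransversal L V) :
    ∃ q : Y →L[ℝ] Y, (∀ y, q y ∈ V) ∧ ∀ y ∈ V, q y = y := by
  have := hV.finite
  obtain ⟨f, hf⟩ := Submodule.ClosedComplemented.of_finiteDimensional V
  exact ⟨V.subtypeL.comp f, fun y => (f y).2, fun y hy => congrArg Subtype.val (hf ⟨y, hy⟩)⟩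

theorem IsTransversal.finite_comap {L : Λ → X →L[ℝ] Y} (hL : IsFredholmFamily L)
    {V : Submodule ℝ Y} (hV : IsTransversal L V) (l : Λ) :
    FiniteDimensional ℝ (V.comap (L l).toLinearMap) := by
  have h1 := hV.finite
  have h2 := (hL.isFredholm l).finite_ker
  refine .of_fg (Submodule.fg_of_fg_map_of_fg_inf_ker (L l).toLinearMap ?_ ?_)
  · have h3 : (V.comap (L l).toLinearMap).map (L l).toLinearMap ≤ V := Submodule.map_comap_le _ _
    have := Submodule.finiteDimensional_of_le h3
    exact Submodule.fg_iff_finiteDimensional _ |>.2 this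
  · have := Submodule.finiteDimensional_of_le
      (inf_le_right : V.comap (L l).toLinearMap ⊓ (L l).ker ≤ (L l).ker)
    exact Submodule.fg_iff_finiteDimensional _ |>.2 this

theorem IsTransversal.exists_proj_comap [CompactSpace Λ] [T2Space Λ] [CompleteSpace Y]
    {L : Λ → X →L[ℝ] Y} (hL : IsFredholmFamily L) {V : Submodule ℝ Y} (hV : IsTransversal L V) :
    ∃ p : Λ → X →L[ℝ] X, Continuous p ∧ (∀ l x, p l x ∈ V.comap (L l).toLinearMap) ∧
      ∀ l, ∀ x ∈ V.comap (L l).toLinearMap, p l x = x := by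
  obtain ⟨s, hs, hsV⟩ := exists_parametrix hL hV
  obtain ⟨q, hqV, hq⟩ := hV.exists_proj
  have hLc := hL.continuous
  refine ⟨fun l => ContinuousLinearMap.id ℝ X -
    (s l).comp ((ContinuousLinearMap.id ℝ Y - q).comp (L l)), by fun_prop, fun l x => ?_,
    fun l x hx => ?_⟩
  · have h := V.sub_mem (hqV (L l x)) (hsV l (L l x - q (L l x)))
    have h2 : L l (x - s l (L l x - q (L l x))) =
        q (L l x) - (L l (s l (L l x - q (L l x))) - (L l x - q (L l x))) := by
      rw [map_sub]
      abel
    rw [← h2] at h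
    exact h
  · have h : q (L l x) = L l x := hq _ hx
    simp [h]

variable [CompactSpace Λ] [T2Space Λ] [ConnectedSpace Λ] [CompleteSpace X] [CompleteSpace Y]

/-- The bundle `E(L, V)` with fibres `(L l)⁻¹(V)`. -/
def kernelBundle {L : Λ → X →L[ℝ] Y} (hL : IsFredholmFamily L) {V : Submodule ℝ Y}
    (hV : IsTransversal L V) : RealVectorBundle Λ :=
  subbundle (fun l => V.comap (L l).toLinearMap) (hV.finite_comap hL) (hV.exists_proj_comap hL)

/-- The class `[E(L, V)] - [Θ(V)]` in `KO(Λ)`. -/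
def indexClass {L : Λ → X →L[ℝ] Y} (hL : IsFredholmFamily L) {V : Submodule ℝ Y}
    (hV : IsTransversal L V) : KO Λ :=
  haveI := hV.finite
  KO.of (kernelBundle hL hV) - KO.of (RealVectorBundle.trivial Λ V)

/-- The index bundle `[E(L, V)] - [Θ(V)]` of a family of Fredholm operators, for some transversal
subspace `V`; by `indexBundle_eq` it does not depend on the choice of `V`. -/
def indexBundle {L : Λ → X →L[ℝ] Y} (hL : IsFredholmFamily L) : KO Λ :=
  indexClass hL (exists_isTransversal hL).choose_spec

attribute [local instance] subTop in
theorem kernelBundle_continuous_iff {L : Λ → X →L[ℝ] Y} (hL : IsFredholmFamily L)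
    {V : Submodule ℝ Y} (hV : IsTransversal L V) {Z : Type*} [TopologicalSpace Z]
    {f : Z → (kernelBundle hL hV).Total} :
    Continuous f ↔ Continuous (fun z => ((f z).1, Subtype.val (show V.comap (L (f z).1).toLinearMap from (f z).2))) :=
  (subTop_isInducing (V.comap (L (Classical.arbitrary Λ)).toLinearMap)
    (fun l => V.comap (L l).toLinearMap)).continuous_iff

theorem indexClass_eq_of_le {L : Λ → X →L[ℝ] Y} (hL : IsFredholmFamily L) {V W : Submodule ℝ Y}
    (hV : IsTransversal L V) (hW : IsTransversal L W) (hVW : V ≤ W) :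
    indexClass hL hV = indexClass hL hW := by
  have := hV.finite
  have := hW.finite
  obtain ⟨s, hs, hsV⟩ := exists_parametrix hL hV
  obtain ⟨q, hqV, hq⟩ := hV.exists_proj
  have hLc := hL.continuous
  let u : Y →L[ℝ] Y := ContinuousLinearMap.id ℝ Y - q
  have hu : ∀ y ∈ V, u y = 0 := fun y hy => by simp [u, hq y hy]
  have huq : ∀ y, u y + q y = y := fun y => by simp [u]
  have huW : ∀ y ∈ W, u y ∈ W := fun y hy => W.sub_mem hy (hVW (hqV y))
  have huu : ∀ y, u (u y) = u y := fun y => by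
    conv_rhs => rw [← huq y, map_add, hu _ (hqV y), add_zero]
  have hqu : ∀ y, q (u y) = 0 := fun y => by simp [u, hq _ (hqV y)]
  have hLs : ∀ l y, u (L l (s l (u y))) = u y := fun l y => by
    have h := hu _ (hsV l (u y))
    rw [map_sub, sub_eq_zero, huu] at h
    exact h
  let A : RealVectorBundle Λ := .sum (kernelBundle hL hV) (.trivial Λ W)
  let B : RealVectorBundle Λ := .sum (kernelBundle hL hW) (.trivial Λ V)
  have hto : ∀ l, ∀ x ∈ V.comap (L l).toLinearMap, ∀ w ∈ W,
      x + s l (u w) ∈ W.comap (L l).toLinearMap := fun l x hx w hw => by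
    have h1 := W.add_mem (hVW hx) (W.add_mem (hVW (hsV l (u w))) (huW w hw))
    simpa using h1
  have hinv : ∀ l, ∀ x, x - s l (u (L l x)) ∈ V.comap (L l).toLinearMap := fun l x => by
    have h1 := V.sub_mem (hqV (L l x)) (hsV l (u (L l x)))
    have h2 : L l (x - s l (u (L l x))) = q (L l x) - (L l (s l (u (L l x))) - u (L l x)) := by
      rw [map_sub]
      nth_rewrite 1 [← huq (L l x)]
      abel
    change L l (x - s l (u (L l x))) ∈ V
    rw [h2]
    exact h1
  let φ : ∀ l, ((V.comap (L l).toLinearMap) × W) ≃ₗ[ℝ] ((W.comap (L l).toLinearMap) × V) :=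
    fun l =>
    { toFun := fun x => (⟨x.1 + s l (u x.2), hto l _ x.1.2 _ x.2.2⟩, ⟨q x.2, hqV _⟩)
      map_add' := fun x y => by
        ext
        · simp; abel
        · simp
      map_smul' := fun c x => by
        ext
        · simp
        · simp
      invFun := fun x => (⟨x.1 - s l (u (L l x.1)), hinv l _⟩,
        ⟨u (L l x.1) + x.2, W.add_mem (huW _ x.1.2) (hVW x.2.2)⟩)
      left_inv := fun x => by
        have h1 : u (L l x.1) = 0 := hu _ x.1.2
        ext
        · simp [h1, hLs]
        · simp [h1, hLs, huq]
      right_inv := fun x => by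
        have h1 : u x.2 = 0 := hu _ x.2.2
        ext
        · simp [h1, huu]
        · simp [hqu, hq _ x.2.2] }
  have key : RealVectorBundle.Iso A B := by
    have hA1 : Continuous fun p : A.Total => (p.1, ((show (V.comap (L p.1).toLinearMap) × W from p.2).1 : X)) :=
      (kernelBundle_continuous_iff hL hV).1 RealVectorBundle.continuous_fst
    have hA2 : Continuous fun p : A.Total => (show (V.comap (L p.1).toLinearMap) × W from p.2).2 :=
      (RealVectorBundle.continuous_trivial.1 RealVectorBundle.continuous_snd).2
    have hB1 : Continuous fun p : B.Total => (p.1, ((show (W.comap (L p.1).toLinearMap) × V from p.2).1 : X)) :=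
      (kernelBundle_continuous_iff hL hW).1 RealVectorBundle.continuous_fst
    have hB2 : Continuous fun p : B.Total => (show (W.comap (L p.1).toLinearMap) × V from p.2).2 :=
      (RealVectorBundle.continuous_trivial.1 RealVectorBundle.continuous_snd).2
    refine ⟨φ, RealVectorBundle.continuous_pair ((kernelBundle_continuous_iff hL hW).2 ?_) 
        (RealVectorBundle.continuous_trivial.2 ⟨hA1.fst, ?_⟩), 
      RealVectorBundle.continuous_pair ((kernelBundle_continuous_iff hL hV).2 ?_) 
        (RealVectorBundle.continuous_trivial.2 ⟨hB1.fst, ?_⟩)⟩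
    · exact hA1.fst.prodMk (hA1.snd.add ((hs.comp hA1.fst).clm_apply
        (u.continuous.comp (continuous_subtype_val.comp hA2))))
    · exact (q.continuous.comp (continuous_subtype_val.comp hA2)).subtype_mk _
    · exact hB1.fst.prodMk (hB1.snd.sub ((hs.comp hB1.fst).clm_apply
        (u.continuous.comp ((hLc.comp hB1.fst).clm_apply hB1.snd))))
    · exact ((u.continuous.comp ((hLc.comp hB1.fst).clm_apply hB1.snd)).add
        (continuous_subtype_val.comp hB2)).subtype_mk _
  have h2 : KO.of (kernelBundle hL hV) + KO.of (.trivial Λ W) =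
      KO.of (kernelBundle hL hW) + KO.of (.trivial Λ V) := by
    unfold KO.of
    rw [← map_add, ← map_add, ← RealVectorBundle.cls_sum, ← RealVectorBundle.cls_sum,
      RealVectorBundle.cls_eq key]
  unfold indexClass
  rw [sub_eq_sub_iff_add_eq_add, h2]

/-- The index bundle does not depend on the choice of the transversal subspace. -/
theorem indexBundle_eq {L : Λ → X →L[ℝ] Y} (hL : IsFredholmFamily L) {V : Submodule ℝ Y}
    (hV : IsTransversal L V) : indexBundle hL = indexClass hL hV := by
  have hV' := (exists_isTransversal hL).choose_spec
  have hs : IsTransversal L (V ⊔ (exists_isTransversal hL).choose) := by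
    have := hV.finite
    have := hV'.finite
    exact ⟨inferInstance, fun l => eq_top_iff.2
      ((hV.sup_eq_top l).ge.trans (sup_le_sup_left le_sup_left _))⟩
  exact (indexClass_eq_of_le hL hV' hs le_sup_right).trans
    (indexClass_eq_of_le hL hV hs le_sup_left).symm

end index

section dynamics

open Filter Set

variable {Λ : Type u} [TopologicalSpace Λ] {d : ℕ}

/-- The Banach space `ℓ₀(ℝᵈ)` of two-sided sequences in `ℝᵈ` tending to `0` at `±∞`, with the
supremum norm. -/
abbrev EllZero (d : ℕ) : Type := ZeroAtInftyContinuousMap ℤ (EuclideanSpace ℝ (Fin d))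

/-- The left shift `(S φ)(n) = φ (n + 1)`. -/
def leftShift (d : ℕ) : EllZero d →L[ℝ] EllZero d :=
  LinearMap.mkContinuous
    { toFun := fun φ =>
        { toFun := fun n => φ (n + 1)
          continuous_toFun := continuous_of_discreteTopology
          zero_at_infty' := φ.zero_at_infty'.comp
            (Homeomorph.addRight (1 : ℤ)).isClosedEmbedding.tendsto_cocompact }
      map_add' := fun _ _ => rfl
      map_smul' := fun _ _ => rfl }
    1 fun φ => by
      rw [one_mul, ← ZeroAtInftyContinuousMap.norm_toBCF_eq_norm,
        BoundedContinuousFunction.norm_le (norm_nonneg _)]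
      intro n
      rw [← ZeroAtInftyContinuousMap.norm_toBCF_eq_norm]
      exact φ.toBCF.norm_coe_le_norm (n + 1)

/-- The multiplication operator `(N φ)(n) = a n (φ n)` of a bounded sequence of matrices. -/
def nemitski (a : ℤ → EuclideanSpace ℝ (Fin d) →L[ℝ] EuclideanSpace ℝ (Fin d))
    (ha : ∃ C, ∀ n, ‖a n‖ ≤ C) : EllZero d →L[ℝ] EllZero d :=
  LinearMap.mkContinuousOfExistsBound
    { toFun := fun φ =>
        { toFun := fun n => a n (φ n)
          continuous_toFun := continuous_of_discreteTopology
          zero_at_infty' := by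
            obtain ⟨C, hC⟩ := ha
            refine squeeze_zero_norm (a := fun n => C * ‖φ n‖) (fun n => ?_) ?_
            · exact (a n).le_of_opNorm_le (hC n) _
            · simpa using (φ.zero_at_infty'.norm).const_mul C }
      map_add' := fun φ ψ => by ext n; simp
      map_smul' := fun c φ => by ext n; simp } <| by
    obtain ⟨C, hC⟩ := ha
    refine ⟨C, fun φ => ?_⟩
    have hC0 : 0 ≤ C := (norm_nonneg _).trans (hC 0)
    rw [← ZeroAtInftyContinuousMap.norm_toBCF_eq_norm,
      BoundedContinuousFunction.norm_le (by positivity)]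
    intro n
    refine ((a n).le_of_opNorm_le (hC n) _).trans ?_
    gcongr
    rw [← ZeroAtInftyContinuousMap.norm_toBCF_eq_norm]
    exact φ.toBCF.norm_coe_le_norm n

/-- A parametrized linear discrete vector field: a sequence of families of `d × d` matrices, which
is equicontinuous and pointwise bounded. -/
structure LinearField (Λ : Type u) [TopologicalSpace Λ] (d : ℕ) where
  toFun : ℤ → Λ → EuclideanSpace ℝ (Fin d) →L[ℝ] EuclideanSpace ℝ (Fin d)
  equicontinuous : Equicontinuous toFun
  bounded : ∀ l, ∃ C, ∀ n, ‖toFun n l‖ ≤ C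

namespace LinearField

instance : Add (LinearField Λ d) where
  add A B :=
    { toFun := fun n l => A.toFun n l + B.toFun n l
      equicontinuous := by
        intro l
        rw [Metric.equicontinuousAt_iff_right]
        intro ε hε
        filter_upwards [Metric.equicontinuousAt_iff_right.1 (A.equicontinuous l) (ε / 2) (half_pos hε),
          Metric.equicontinuousAt_iff_right.1 (B.equicontinuous l) (ε / 2) (half_pos hε)]
          with x hA hB n
        exact (dist_add_add_le _ _ _ _).trans_lt (by linarith [hA n, hB n])
      bounded := fun l => by
        obtain ⟨C, hC⟩ := A.bounded l
        obtain ⟨C', hC'⟩ := B.bounded l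
        exact ⟨C + C', fun n => (norm_add_le _ _).trans (add_le_add (hC n) (hC' n))⟩ }

/-- The family of operators `L_A(l) = S - N_{A(l)}` on `ℓ₀(ℝᵈ)`. -/
def operator (A : LinearField Λ d) (l : Λ) : EllZero d →L[ℝ] EllZero d :=
  leftShift d - nemitski (fun n => A.toFun n l) (A.bounded l)

end LinearField

/-- A real square matrix is hyperbolic if it has no complex eigenvalue of modulus one. -/
def IsHyperbolic (B : EuclideanSpace ℝ (Fin d) →L[ℝ] EuclideanSpace ℝ (Fin d)) : Prop :=
  ∀ z : ℂ, ‖z‖ = 1 → z ∉ spectrum ℂ (LinearMap.baseChange ℂ B.toLinearMap)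

/-- `A n l` converges, uniformly in `l`, to hyperbolic matrices as `n → ∞` and as `n → -∞`. -/
def LinearField.IsAsymptoticallyHyperbolic (A : LinearField Λ d) : Prop :=
  ∃ Ap Am : Λ → EuclideanSpace ℝ (Fin d) →L[ℝ] EuclideanSpace ℝ (Fin d),
    (∀ l, IsHyperbolic (Ap l)) ∧ (∀ l, IsHyperbolic (Am l)) ∧
    TendstoUniformly A.toFun Ap atTop ∧ TendstoUniformly A.toFun Am atBot

/-- `D` is `γp`-small at `+∞` and `γm`-small at `-∞`. -/
def LinearField.IsSmallAtInfty (D : LinearField Λ d) (γp γm : ℝ) : Prop :=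
  (∃ κ : ℤ, 0 ≤ κ ∧ ∀ n, κ ≤ n → ∀ l, ‖D.toFun n l‖ ≤ γp) ∧
  (∃ κ : ℤ, κ ≤ 0 ∧ ∀ n, n ≤ κ → ∀ l, ‖D.toFun n l‖ ≤ γm)

/-- The transition operator `Φ(n + m, n) = a (n + m - 1) ∘ ⋯ ∘ a n`. -/
def transition (a : ℤ → EuclideanSpace ℝ (Fin d) →L[ℝ] EuclideanSpace ℝ (Fin d)) (n : ℤ) :
    ℕ → EuclideanSpace ℝ (Fin d) →L[ℝ] EuclideanSpace ℝ (Fin d)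
  | 0 => ContinuousLinearMap.id ℝ _
  | m + 1 => (a (n + m)).comp (transition a n m)

/-- `P` is a bounded, invariant, regular projector on the discrete interval `I` with respect to
which `a` has an exponential dichotomy on `I`. -/
structure IsDichotomy (a P : ℤ → EuclideanSpace ℝ (Fin d) →L[ℝ] EuclideanSpace ℝ (Fin d))
    (I : Set ℤ) : Prop where
  projector : ∀ n ∈ I, (P n).comp (P n) = P n
  bounded : ∃ C, ∀ n ∈ I, ‖P n‖ ≤ C
  invariant : ∀ n, n ∈ I → n + 1 ∈ I → (P (n + 1)).comp (a n) = (a n).comp (P n)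
  regular : ∀ n, n ∈ I → n + 1 ∈ I → BijOn (a n) (P n).ker (P (n + 1)).ker
  estimates : ∃ K α : ℝ, 1 ≤ K ∧ α ∈ Ioo 0 1 ∧ ∀ (n : ℤ) (m : ℕ), n ∈ I → n + m ∈ I → ∀ x,
    ‖transition a n m (P n x)‖ ≤ K * α ^ m * ‖P n x‖ ∧
    1 / K * (1 / α) ^ m * ‖x - P n x‖ ≤ ‖transition a n m (x - P n x)‖

/-- `A` has on `I` an exponential dichotomy for every parameter, with respect to projectors
depending continuously on the parameter. -/
def LinearField.HasDichotomy (A : LinearField Λ d) (I : Set ℤ) : Prop :=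
  ∃ P : Λ → ℤ → EuclideanSpace ℝ (Fin d) →L[ℝ] EuclideanSpace ℝ (Fin d),
    (∀ n ∈ I, Continuous fun l => P l n) ∧ ∀ l, IsDichotomy (fun n => A.toFun n l) (P l) I

/-- The constants `γp, γm` are such that every perturbation of `A` that is `γp`-small at `+∞` and
`γm`-small at `-∞` has exponential dichotomies on a right and on a left half-line. -/
structure LinearField.IsDichotomyRadius (A : LinearField Λ d) (γp γm : ℝ) : Prop where
  pos_right : 0 < γp
  pos_left : 0 < γm
  right : ∀ D : LinearField Λ d, D.IsSmallAtInfty γp γm → ∃ κ, (A + D).HasDichotomy (Ici κ)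
  left : ∀ D : LinearField Λ d, D.IsSmallAtInfty γp γm → ∃ κ, (A + D).HasDichotomy (Iic κ)

end dynamics

end

/-! The equality of index bundles is a homotopy argument along `A + t • D`, `t ∈ [0, 1]`. If `D` is
small at infinity, so is every `t • D`, with the same constants; admissibility therefore gives
dichotomies on both half-lines for every `A + t • D`. Two half-line dichotomies make the operator on
`ℓ₀` Fredholm (`isFredholm_of_isDichotomy`): on the left half-line a null solution in `ℓ₀` is
determined by one value, and Green sums on the two half-lines solve the inhomogeneous equation up to
finitely many indices. The index bundle is constant along such a path
(`indexBundle_eq_of_homotopy`): choose one transversal subspace `V` for the whole cylinder `[0, 1] ×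
Λ`; projections onto the fibres `L⁻¹(V)` form a continuous path of idempotents in the Banach algebra
`C(Λ, X →L[ℝ] X)`, and nearby idempotents are conjugate, so the kernel bundles are locally constant
up to isomorphism.

Admissible pairs come from invertibility on `ℓ₀`. For a hyperbolic matrix `M` with characteristic
polynomial `p`, the shift `S` satisfies `p(S) = p(S) - p(M) = (S - M) c` with commuting factors, so
it suffices that `p(S)` is invertible. This is proved by real algebra
(`isUnit_aeval_of_forall_norm_ne_one`): each irreducible real factor of `p` divides a trinomial in a
high power of `S`, one of whose end coefficients dominates. By a Neumann series, with compactness of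
`Λ` for uniformity, invertibility persists for fields uniformly close to a hyperbolic family. An
inverse on `ℓ₀` yields a dichotomy on `ℤ` (`IsGreenOperator.isDichotomy`): the projector at `n` is
the value at `n` of the response to an impulse at `n - 1`, and the responses decay exponentially
because conjugation with a slowly varying exponential weight is a small perturbation. Finally, a
field close to its limit only on a half-line is replaced by the limit elsewhere, and the resulting
dichotomy is restricted. -/

open Filter Set Topology Polynomial

/-! ### Polynomials evaluated at an invertible isometry. -/

section BanachAlgebra

variable {𝔸 : Type*} [NormedRing 𝔸]

theorem isUnit_of_norm_inv_mul_norm_sub_lt_one [CompleteSpace 𝔸] {T T' R : 𝔸}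
    (hTR : T * R = 1) (hRT : R * T = 1) (h : ‖R‖ * ‖T - T'‖ < 1) : IsUnit T' := by
  have h1 : IsUnit (1 - R * (T - T')) :=
    isUnit_one_sub_of_norm_lt_one ((norm_mul_le _ _).trans_lt h)
  have h2 : T' = T * (1 - R * (T - T')) := by
    rw [mul_sub, mul_one, ← mul_assoc, hTR, one_mul, sub_sub_cancel]
  rw [h2]
  exact IsUnit.mul ⟨⟨T, R, hTR, hRT⟩, rfl⟩ h1

/-- Asking for `‖1‖ ≤ 1` instead of equality admits the zero algebra, which occurs for `d = 0`. -/
theorem norm_pow_le_one_of_norm_le_one {a : 𝔸} (h1 : ‖(1 : 𝔸)‖ ≤ 1) (ha : ‖a‖ ≤ 1) (n : ℕ) :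
    ‖a ^ n‖ ≤ 1 := by
  induction n with
  | zero => simpa using h1
  | succ n ih =>
    rw [pow_succ]
    exact (norm_mul_le _ _).trans (mul_le_one₀ ih (norm_nonneg _) ha)

variable [NormedAlgebra ℝ 𝔸] [CompleteSpace 𝔸]

/-- A real trinomial in powers of an invertible isometry is invertible, if its lowest or its highest
coefficient dominates. -/
theorem isUnit_trinomial {s t : 𝔸} (hst : s * t = 1) (hts : t * s = 1) (h1 : ‖(1 : 𝔸)‖ ≤ 1)
    (hs : ‖s‖ ≤ 1) (ht : ‖t‖ ≤ 1) (N : ℕ) (w : ℂ) (hw : ‖w‖ < 1 / 4 ∨ 3 < ‖w‖) :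
    IsUnit (aeval s (X ^ N * X ^ N - C (2 * w.re) * X ^ N + C (‖w‖ ^ 2) : ℝ[X])) := by
  have hre : |w.re| ≤ ‖w‖ := Complex.abs_re_le_norm w
  have e : aeval s (X ^ N * X ^ N - C (2 * w.re) * X ^ N + C (‖w‖ ^ 2) : ℝ[X]) =
      s ^ N * s ^ N - (2 * w.re) • s ^ N + (‖w‖ ^ 2) • (1 : 𝔸) := by
    simp only [map_add, map_sub, map_mul (aeval s), map_pow (aeval s), aeval_X, aeval_C,
      Algebra.algebraMap_eq_smul_one, smul_one_mul]
  have hsN : ‖s ^ N‖ ≤ 1 := norm_pow_le_one_of_norm_le_one h1 hs N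
  have htN : ‖t ^ N‖ ≤ 1 := norm_pow_le_one_of_norm_le_one h1 ht N
  have hc : Commute s t := hst.trans hts.symm
  have hstN : s ^ N * t ^ N = 1 := by rw [← hc.mul_pow, hst, one_pow]
  have htsN : t ^ N * s ^ N = 1 := by rw [← hc.symm.mul_pow, hts, one_pow]
  have hmid : ‖(2 * w.re) • s ^ N‖ ≤ 2 * ‖w‖ := by
    rw [norm_smul, Real.norm_eq_abs, abs_mul, abs_two]
    nlinarith [norm_nonneg (s ^ N), abs_nonneg w.re]
  rw [e]
  rcases hw with hw | hw
  · refine isUnit_of_norm_inv_mul_norm_sub_lt_one (T := s ^ N * s ^ N) (R := t ^ N * t ^ N) ?_ ?_ ?_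
    · rw [mul_assoc, ← mul_assoc (s ^ N) (t ^ N), hstN, one_mul, hstN]
    · rw [mul_assoc, ← mul_assoc (t ^ N) (s ^ N), htsN, one_mul, htsN]
    · have h2 : ‖t ^ N * t ^ N‖ ≤ 1 :=
        (norm_mul_le _ _).trans (mul_le_one₀ htN (norm_nonneg _) htN)
      have h3 : ‖(‖w‖ ^ 2) • (1 : 𝔸)‖ ≤ ‖w‖ ^ 2 := by
        rw [norm_smul, norm_pow, norm_norm]
        nlinarith [sq_nonneg ‖w‖]
      have h4 : s ^ N * s ^ N - (s ^ N * s ^ N - (2 * w.re) • s ^ N + (‖w‖ ^ 2) • (1 : 𝔸)) =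
        (2 * w.re) • s ^ N - (‖w‖ ^ 2) • (1 : 𝔸) := by abel
      rw [h4]
      have h5 := norm_sub_le ((2 * w.re) • s ^ N) ((‖w‖ ^ 2) • (1 : 𝔸))
      have h6 : ‖(2 * w.re) • s ^ N - (‖w‖ ^ 2) • (1 : 𝔸)‖ < 1 := by
        nlinarith [norm_nonneg w]
      exact (mul_le_of_le_one_left (norm_nonneg _) h2).trans_lt h6
  · have hw0 : ‖w‖ ^ 2 ≠ 0 := by positivity
    refine isUnit_of_norm_inv_mul_norm_sub_lt_one (T := (‖w‖ ^ 2) • (1 : 𝔸))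
      (R := (‖w‖ ^ 2)⁻¹ • (1 : 𝔸)) ?_ ?_ ?_
    · simp [smul_smul, hw0]
    · simp [smul_smul, hw0]
    · have h2 : ‖(‖w‖ ^ 2)⁻¹ • (1 : 𝔸)‖ ≤ (‖w‖ ^ 2)⁻¹ := by
        rw [norm_smul, norm_inv, norm_pow, norm_norm]
        exact mul_le_of_le_one_right (by positivity) h1
      have h3 : ‖s ^ N * s ^ N‖ ≤ 1 :=
        (norm_mul_le _ _).trans (mul_le_one₀ hsN (norm_nonneg _) hsN)
      have h4 : (‖w‖ ^ 2) • (1 : 𝔸) - (s ^ N * s ^ N - (2 * w.re) • s ^ N + (‖w‖ ^ 2) • (1 : 𝔸)) =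
        (2 * w.re) • s ^ N - s ^ N * s ^ N := by abel
      rw [h4]
      have h5 := norm_sub_le ((2 * w.re) • s ^ N) (s ^ N * s ^ N)
      have h6 : ‖(2 * w.re) • s ^ N - s ^ N * s ^ N‖ < ‖w‖ ^ 2 := by
        nlinarith
      calc _ ≤ (‖w‖ ^ 2)⁻¹ * ‖(2 * w.re) • s ^ N - s ^ N * s ^ N‖ := by gcongr
        _ < (‖w‖ ^ 2)⁻¹ * ‖w‖ ^ 2 := by gcongr
        _ = 1 := inv_mul_cancel₀ hw0

/-- The thresholds are those of `isUnit_trinomial`: `2r + r² < 1` for `0 ≤ r < 1/4`, and `2r + 1 <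
r²` for `r > 3`. -/
theorem exists_pow_norm_small_or_large {z : ℂ} (hz : ‖z‖ ≠ 1) :
    ∃ N : ℕ, ‖z ^ N‖ < 1 / 4 ∨ 3 < ‖z ^ N‖ := by
  simp only [norm_pow]
  rcases lt_or_gt_of_ne hz with h | h
  · obtain ⟨N, hN⟩ := exists_pow_lt_of_lt_one (show (0 : ℝ) < 1 / 4 by norm_num) h
    exact ⟨N, .inl hN⟩
  · obtain ⟨N, hN⟩ := pow_unbounded_of_one_lt 3 h
    exact ⟨N, .inr hN⟩

/-- A real polynomial without complex roots of modulus one is invertible at an invertible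
isometry. -/
theorem isUnit_aeval_of_forall_norm_ne_one {s t : 𝔸} (hst : s * t = 1) (hts : t * s = 1)
    (h1 : ‖(1 : 𝔸)‖ ≤ 1) (hs : ‖s‖ ≤ 1) (ht : ‖t‖ ≤ 1) (p : ℝ[X]) (hp0 : p ≠ 0)
    (hp : ∀ z : ℂ, aeval z p = 0 → ‖z‖ ≠ 1) : IsUnit (aeval s p) := by
  induction hn : p.natDegree using Nat.strong_induction_on generalizing p with
  | _ n ih =>
  by_cases hdeg : p.degree = 0
  · rw [eq_C_of_degree_eq_zero hdeg, aeval_C]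
    refine IsUnit.map (algebraMap ℝ 𝔸) (isUnit_iff_ne_zero.2 fun h => hp0 ?_)
    rw [eq_C_of_degree_eq_zero hdeg, h, C_0]
  obtain ⟨z, hz⟩ := Complex.exists_root (f := p.map (algebraMap ℝ ℂ)) (by
    rw [degree_map]
    exact lt_of_le_of_ne (zero_le_degree_iff.2 hp0) (Ne.symm hdeg))
  have hz : aeval z p = 0 := by rwa [IsRoot, eval_map_algebraMap] at hz
  -- A real factor with root `z` divides both `p` and a trinomial.
  have key : ∃ q : ℝ[X], q ∣ p ∧ 0 < q.natDegree ∧ ∀ r : ℝ[X], aeval z r = 0 → q ∣ r := by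
    by_cases him : z.im = 0
    · have hzr : z = (z.re : ℂ) := Complex.ext rfl (by simp [him])
      have h : ∀ r : ℝ[X], aeval z r = 0 → X - C z.re ∣ r := by
        intro r hr
        rw [dvd_iff_isRoot, IsRoot]
        rw [hzr] at hr
        have h2 := aeval_algebraMap_apply ℂ z.re r
        rw [Complex.coe_algebraMap, hr, coe_aeval_eq_eval] at h2
        exact_mod_cast h2.symm
      exact ⟨X - C z.re, h p hz, by simp, h⟩
    · have h : ∀ r : ℝ[X], aeval z r = 0 → X ^ 2 - C (2 * z.re) * X + C (‖z‖ ^ 2) ∣ r :=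
        fun r hr => quadratic_dvd_of_aeval_eq_zero_im_ne_zero r hr him
      refine ⟨_, h p hz, ?_, h⟩
      have : (X ^ 2 - C (2 * z.re) * X + C (‖z‖ ^ 2) : ℝ[X]).natDegree = 2 := by compute_degree!
      omega
  obtain ⟨q, ⟨r, rfl⟩, hqdeg, hq⟩ := key
  have hr0 : r ≠ 0 := right_ne_zero_of_mul hp0
  have hq0 : q ≠ 0 := left_ne_zero_of_mul hp0
  have hr : IsUnit (aeval s r) := by
    refine ih r.natDegree ?_ r hr0 (fun y hy => hp y (by rw [map_mul, hy, mul_zero])) rfl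
    rw [← hn, natDegree_mul hq0 hr0]
    omega
  obtain ⟨N, hN⟩ := exists_pow_norm_small_or_large (hp z hz)
  -- The trinomial is `(X ^ N - w)(X ^ N - conj w)` with `w = z ^ N`, so it vanishes at `z` and is a
  -- multiple of `q`. Its value at `s` is invertible, and so is the commuting factor `aeval s q`.
  obtain ⟨c, hc⟩ := hq (X ^ N * X ^ N - C (2 * (z ^ N).re) * X ^ N + C (‖z ^ N‖ ^ 2)) (by
    have e1 : ((2 * (z ^ N).re : ℝ) : ℂ) = z ^ N + (starRingEnd ℂ) (z ^ N) :=
      (Complex.add_conj (z ^ N)).symm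
    have e2 : ((‖z ^ N‖ ^ 2 : ℝ) : ℂ) = z ^ N * (starRingEnd ℂ) (z ^ N) := by
      rw [Complex.mul_conj, Complex.normSq_eq_norm_sq]
    simp only [map_add, map_sub, map_mul (aeval z), map_pow (aeval z), aeval_X, aeval_C,
      Complex.coe_algebraMap]
    rw [e1, e2]
    ring)
  have h := isUnit_trinomial hst hts h1 hs ht N (z ^ N) hN
  rw [hc, map_mul, ((Commute.all q c).map (aeval s)).isUnit_mul_iff] at h
  rw [map_mul]
  exact h.1.mul hr

-- On monomials this is the geometric sum identity; the general case is linear. Commutation of `c`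
-- with `a - b` is recorded so that invertibility of the product passes to the factor `a - b`.
omit [CompleteSpace 𝔸] in
theorem Commute.exists_mul_eq_aeval_sub_aeval {a b : 𝔸} (h : Commute a b) (p : ℝ[X]) :
    ∃ c, Commute (a - b) c ∧ (a - b) * c = aeval a p - aeval b p := by
  induction p using Polynomial.induction_on' with
  | add p q hp hq =>
    obtain ⟨c, hc, hc'⟩ := hp
    obtain ⟨e, he, he'⟩ := hq
    exact ⟨c + e, hc.add_right he, by rw [mul_add, hc', he', map_add, map_add]; abel⟩
  | monomial n r =>
    have h1 := h.mul_geom_sum₂ n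
    have h2 := h.geom_sum₂_mul n
    refine ⟨r • ∑ i ∈ Finset.range n, a ^ i * b ^ (n - 1 - i), ?_, ?_⟩
    · exact Commute.smul_right (h1.trans h2.symm) r
    · rw [mul_smul_comm, h1, smul_sub]
      simp [aeval_monomial, Algebra.smul_def]

/-- If `s` is an invertible isometry and `m` commutes with `s` and is annihilated by a real
polynomial without complex roots of modulus one, then `s - m` is invertible. -/
theorem isUnit_sub_of_aeval_eq_zero {s t m : 𝔸} (hst : s * t = 1) (hts : t * s = 1)
    (h1 : ‖(1 : 𝔸)‖ ≤ 1) (hs : ‖s‖ ≤ 1) (ht : ‖t‖ ≤ 1) (hsm : s * m = m * s) (p : ℝ[X])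
    (hp0 : p ≠ 0) (hp : ∀ z : ℂ, aeval z p = 0 → ‖z‖ ≠ 1) (hm : aeval m p = 0) :
    IsUnit (s - m) := by
  obtain ⟨c, hc, hc'⟩ := Commute.exists_mul_eq_aeval_sub_aeval hsm p
  have h := isUnit_aeval_of_forall_norm_ne_one hst hts h1 hs ht p hp0 hp
  rw [hm, sub_zero] at hc'
  rw [← hc', hc.isUnit_mul_iff] at h
  exact h.1

end BanachAlgebra

theorem ContinuousLinearMap.isUnit_sub_of_aeval_eq_zero {X : Type*} [NormedAddCommGroup X]
    [NormedSpace ℝ X] [CompleteSpace X] {s t m : X →L[ℝ] X} (hst : ∀ x, s (t x) = x)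
    (hts : ∀ x, t (s x) = x) (hs : ‖s‖ ≤ 1) (ht : ‖t‖ ≤ 1) (hsm : ∀ x, s (m x) = m (s x)) (p : ℝ[X])
    (hp0 : p ≠ 0) (hp : ∀ z : ℂ, aeval z p = 0 → ‖z‖ ≠ 1) (hm : aeval m p = 0) :
    IsUnit (s - m) :=
  _root_.isUnit_sub_of_aeval_eq_zero (ContinuousLinearMap.ext hst) (ContinuousLinearMap.ext hts)
    ContinuousLinearMap.norm_id_le hs ht (ContinuousLinearMap.ext hsm) p hp0 hp hm

theorem ContinuousLinearMap.exists_inverse_of_norm_mul_norm_sub_lt_one {X : Type*}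
    [NormedAddCommGroup X] [NormedSpace ℝ X] [CompleteSpace X] {T T' R : X →L[ℝ] X}
    (hTR : ∀ x, T (R x) = x) (hRT : ∀ x, R (T x) = x) (h : ‖R‖ * ‖T - T'‖ < 1) :
    ∃ R' : X →L[ℝ] X, (∀ x, T' (R' x) = x) ∧ ∀ x, R' (T' x) = x := by
  obtain ⟨u, rfl⟩ := isUnit_of_norm_inv_mul_norm_sub_lt_one (T := T) (T' := T') (R := R)
    (ContinuousLinearMap.ext hTR) (ContinuousLinearMap.ext hRT) h
  exact ⟨(u⁻¹ :), fun x => congrArg (fun f => f x) u.mul_inv,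
    fun x => congrArg (fun f => f x) u.inv_mul⟩

/-! ### Shifts, impulses and constant coefficients on `ℓ₀`. -/

noncomputable section EllZero

variable {d : ℕ}

local notation "𝔼" => EuclideanSpace ℝ (Fin d)

theorem EllZero.norm_apply_le (φ : EllZero d) (n : ℤ) : ‖φ n‖ ≤ ‖φ‖ := by
  rw [← ZeroAtInftyContinuousMap.norm_toBCF_eq_norm]
  exact φ.toBCF.norm_coe_le_norm n

theorem EllZero.norm_le {φ : EllZero d} {C : ℝ} (hC : 0 ≤ C) : ‖φ‖ ≤ C ↔ ∀ n, ‖φ n‖ ≤ C := by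
  rw [← ZeroAtInftyContinuousMap.norm_toBCF_eq_norm]
  exact BoundedContinuousFunction.norm_le hC

@[simp]
theorem nemitski_apply (a : ℤ → 𝔼 →L[ℝ] 𝔼) (ha : ∃ C, ∀ n, ‖a n‖ ≤ C) (φ : EllZero d) (n : ℤ) :
    nemitski a ha φ n = a n (φ n) := rfl

theorem norm_leftShift_le : ‖leftShift d‖ ≤ 1 :=
  LinearMap.mkContinuous_norm_le _ zero_le_one _

theorem norm_nemitski_le {a : ℤ → 𝔼 →L[ℝ] 𝔼} (ha : ∃ C, ∀ n, ‖a n‖ ≤ C) {C : ℝ} (hC : 0 ≤ C)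
    (h : ∀ n, ‖a n‖ ≤ C) : ‖nemitski a ha‖ ≤ C := by
  refine ContinuousLinearMap.opNorm_le_bound _ hC fun φ => ?_
  rw [EllZero.norm_le (by positivity)]
  intro n
  exact ((a n).le_of_opNorm_le (h n) _).trans (by gcongr; exact φ.norm_apply_le n)

/-- The right shift `φ ↦ φ (· - 1)`, inverse to the left shift. -/
def rightShift (d : ℕ) : EllZero d →L[ℝ] EllZero d :=
  LinearMap.mkContinuous
    { toFun := fun φ =>
        { toFun := fun n => φ (n - 1)
          continuous_toFun := continuous_of_discreteTopology
          zero_at_infty' := φ.zero_at_infty'.comp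
            (Homeomorph.subRight (1 : ℤ)).isClosedEmbedding.tendsto_cocompact }
      map_add' := fun _ _ => rfl
      map_smul' := fun _ _ => rfl }
    1 fun φ => by
      rw [one_mul, EllZero.norm_le (norm_nonneg _)]
      exact fun n => φ.norm_apply_le (n - 1)

theorem norm_rightShift_le : ‖rightShift d‖ ≤ 1 :=
  LinearMap.mkContinuous_norm_le _ zero_le_one _

theorem leftShift_rightShift (φ : EllZero d) : leftShift d (rightShift d φ) = φ := by
  ext n : 1
  exact congrArg φ (add_sub_cancel_right n 1)

theorem rightShift_leftShift (φ : EllZero d) : rightShift d (leftShift d φ) = φ := by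
  ext n : 1
  exact congrArg φ (sub_add_cancel n 1)

/-- Evaluation of a sequence at `n`. -/
def evalAt (n : ℤ) : EllZero d →L[ℝ] 𝔼 :=
  LinearMap.mkContinuous
    { toFun := fun φ => φ n
      map_add' := fun _ _ => rfl
      map_smul' := fun _ _ => rfl }
    1 fun φ => by
      rw [one_mul]
      exact φ.norm_apply_le n

/-- A sequence of finite support, as an element of `ℓ₀`. -/
def ofFiniteSupport (f : ℤ → 𝔼) (hf : f.support.Finite) : EllZero d where
  toFun := f
  continuous_toFun := continuous_of_discreteTopology
  zero_at_infty' := by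
    rw [cocompact_eq_cofinite]
    refine tendsto_const_nhds.congr' ?_
    filter_upwards [hf.compl_mem_cofinite] with n hn
    exact (Function.notMem_support.1 hn).symm

/-- The sequence with value `x` at `c` and `0` elsewhere. -/
def singleSeq (c : ℤ) : 𝔼 →L[ℝ] EllZero d :=
  LinearMap.mkContinuous
    { toFun := fun x => ofFiniteSupport (fun n => if n = c then x else 0) <|
        (finite_singleton c).subset fun n hn => by
          by_contra h
          exact hn (if_neg h)
      map_add' := fun x y => by
        ext n : 1
        change (if n = c then x + y else 0) = (if n = c then x else 0) + if n = c then y else 0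
        split_ifs <;> simp
      map_smul' := fun r x => by
        ext n : 1
        change (if n = c then r • x else 0) = r • if n = c then x else 0
        split_ifs <;> simp }
    1 fun x => by
      rw [one_mul, EllZero.norm_le (norm_nonneg _)]
      intro n
      change ‖if n = c then x else 0‖ ≤ ‖x‖
      split_ifs <;> simp

theorem singleSeq_apply (c : ℤ) (x : 𝔼) (n : ℤ) :
    singleSeq c x n = if n = c then x else 0 := rfl

@[simp]
theorem singleSeq_self (c : ℤ) (x : 𝔼) : singleSeq c x c = x := if_pos rfl

theorem singleSeq_of_ne {c n : ℤ} (h : n ≠ c) (x : 𝔼) : singleSeq c x n = 0 := if_neg h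

theorem norm_singleSeq_le (c : ℤ) (x : 𝔼) : ‖singleSeq c x‖ ≤ ‖x‖ := by
  rw [EllZero.norm_le (norm_nonneg _)]
  intro n
  rw [singleSeq_apply]
  split_ifs <;> simp

/-- Multiplication operators with constant coefficients form a subalgebra of the bounded
operators. -/
def constNemitski (d : ℕ) : (EuclideanSpace ℝ (Fin d) →L[ℝ] EuclideanSpace ℝ (Fin d)) →ₐ[ℝ]
    (EllZero d →L[ℝ] EllZero d) where
  toFun M := nemitski (fun _ => M) ⟨‖M‖, fun _ => le_rfl⟩
  map_one' := rfl
  map_mul' _ _ := rfl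
  map_zero' := rfl
  map_add' _ _ := rfl
  commutes' _ := rfl

/-- The spectrum of the complexification is the set of complex roots of the real characteristic
polynomial, which turns hyperbolicity into a condition on a real polynomial. -/
theorem IsHyperbolic.norm_ne_one {M : 𝔼 →L[ℝ] 𝔼} (hM : IsHyperbolic M) {z : ℂ}
    (hz : aeval z M.toLinearMap.charpoly = 0) : ‖z‖ ≠ 1 := by
  intro h1
  refine hM z h1 ?_
  rw [← Module.End.hasEigenvalue_iff_mem_spectrum, Module.End.hasEigenvalue_iff_isRoot_charpoly,
    LinearMap.charpoly_baseChange, IsRoot, eval_map_algebraMap]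
  exact hz

theorem ContinuousLinearMap.aeval_charpoly (M : 𝔼 →L[ℝ] 𝔼) :
    aeval M M.toLinearMap.charpoly = 0 := by
  let ι : (𝔼 →L[ℝ] 𝔼) →ₐ[ℝ] Module.End ℝ 𝔼 :=
    { toFun := fun T => T.toLinearMap
      map_one' := rfl
      map_mul' := fun _ _ => rfl
      map_zero' := rfl
      map_add' := fun _ _ => rfl
      commutes' := fun _ => rfl }
  have h := (aeval_algHom_apply ι M M.toLinearMap.charpoly).symm.trans
    (LinearMap.aeval_self_charpoly M.toLinearMap)
  ext x : 1
  exact LinearMap.congr_fun h x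

/-- For a hyperbolic matrix `M`, the operator `φ ↦ φ (· + 1) - M φ` is invertible on `ℓ₀`. -/
theorem IsHyperbolic.isUnit_leftShift_sub {M : 𝔼 →L[ℝ] 𝔼} (hM : IsHyperbolic M) :
    IsUnit (leftShift d - constNemitski d M) := by
  have hp := (LinearMap.charpoly_monic M.toLinearMap).ne_zero
  have h2 : aeval (constNemitski d M) M.toLinearMap.charpoly = 0 := by
    rw [aeval_algHom_apply, M.aeval_charpoly, map_zero]
  exact ContinuousLinearMap.isUnit_sub_of_aeval_eq_zero leftShift_rightShift rightShift_leftShift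
    norm_leftShift_le norm_rightShift_le (fun _ => rfl) _ hp (fun z hz => hM.norm_ne_one hz) h2

end EllZero

/-! ### From invertibility on `ℓ₀` to an exponential dichotomy on `ℤ`. -/

section Green

variable {d : ℕ}

local notation "𝔼" => EuclideanSpace ℝ (Fin d)

/-- `R` is a bounded inverse of the operator `φ ↦ φ (· + 1) - a φ` on `ℓ₀`. -/
structure IsGreenOperator (a : ℤ → 𝔼 →L[ℝ] 𝔼) (R : EllZero d →L[ℝ] EllZero d) : Prop where
  bounded : ∃ C, ∀ n, ‖a n‖ ≤ C
  solves : ∀ φ n, R φ (n + 1) - a n (R φ n) = φ n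
  unique : ∀ φ ψ : EllZero d, (∀ n, ψ (n + 1) - a n (ψ n) = φ n) → R φ = ψ

theorem isGreenOperator_of_inverse {a : ℤ → 𝔼 →L[ℝ] 𝔼} (ha : ∃ C, ∀ n, ‖a n‖ ≤ C)
    {R : EllZero d →L[ℝ] EllZero d} (hLR : ∀ φ, (leftShift d - nemitski a ha) (R φ) = φ)
    (hRL : ∀ φ, R ((leftShift d - nemitski a ha) φ) = φ) : IsGreenOperator a R where
  bounded := ha
  solves φ n := congrArg (fun ψ : EllZero d => ψ n) (hLR φ)
  unique φ ψ h := by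
    have : (leftShift d - nemitski a ha) ψ = φ := by
      ext n : 1
      exact h n
    rw [← this, hRL]

/-- Consecutive values of the weight `(1 + η) ^ (-|k - c|)` have ratio `(1 + η)⁻¹` to the right of
`c` and `1 + η` to the left. -/
theorem abs_weight_ratio_sub_one_le {η : ℝ} (hη : 0 < η) (c k : ℤ) :
    |(1 + η) ^ ((k - c).natAbs) * ((1 + η)⁻¹) ^ ((k + 1 - c).natAbs) - 1| ≤ η := by
  have h0 : (0 : ℝ) < 1 + η := by positivity
  rcases le_or_gt c k with h | h
  · have e : (k + 1 - c).natAbs = (k - c).natAbs + 1 := by omega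
    rw [e, pow_succ, ← mul_assoc, ← mul_pow, mul_inv_cancel₀ h0.ne', one_pow, one_mul, abs_le]
    have h1 : (1 + η)⁻¹ ≤ 1 := inv_le_one_of_one_le₀ (by linarith)
    have h2 : 1 - η ≤ (1 + η)⁻¹ := by
      rw [← one_div, le_div_iff₀ h0]
      nlinarith
    constructor <;> linarith
  · have e : (k - c).natAbs = (k + 1 - c).natAbs + 1 := by omega
    rw [e, pow_succ, mul_right_comm, ← mul_pow, mul_inv_cancel₀ h0.ne', one_pow, one_mul]
    simp [abs_of_pos hη]

namespace IsGreenOperator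

variable {a : ℤ → EuclideanSpace ℝ (Fin d) →L[ℝ] EuclideanSpace ℝ (Fin d)}
  {R : EllZero d →L[ℝ] EllZero d}

/-- The response to an impulse decays exponentially. -/
theorem exists_decay (h : IsGreenOperator a R) : ∃ C α : ℝ, 1 ≤ C ∧ α ∈ Ioo (0 : ℝ) 1 ∧
    ∀ c x k, ‖R (singleSeq c x) k‖ ≤ C * α ^ (k - c).natAbs * ‖x‖ := by
  -- The bound `1 / 2` serves both the Neumann series for `T + B` and the absorption of `‖R‖ * η *
  -- ‖ψ‖` in the estimate of `ψ`.
  obtain ⟨η, hη, hηR⟩ : ∃ η : ℝ, 0 < η ∧ ‖R‖ * η ≤ 1 / 2 := by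
    refine ⟨1 / (2 * (‖R‖ + 1)), by positivity, ?_⟩
    rw [mul_one_div, div_le_div_iff₀ (by positivity) (by positivity)]
    linarith
  have h0 : (0 : ℝ) < 1 + η := by positivity
  refine ⟨2 * ‖R‖ + 1, (1 + η)⁻¹, by linarith [norm_nonneg R], ⟨by positivity,
    inv_lt_one_of_one_lt₀ (by linarith)⟩, fun c x k => ?_⟩
  -- Conjugation with the weight `w` is a small perturbation.
  let w : ℤ → ℝ := fun k => ((1 + η)⁻¹) ^ (k - c).natAbs
  have hw0 : ∀ k, 0 < w k := fun k => by positivity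
  have hw1 : ∀ k, w k ≤ 1 := fun k => pow_le_one₀ (by positivity)
    (inv_le_one_of_one_le₀ (by linarith))
  let r : ℤ → ℝ := fun k => (1 + η) ^ (k - c).natAbs * w (k + 1)
  have hr : ∀ k, |r k - 1| ≤ η := fun k => abs_weight_ratio_sub_one_le hη c k
  have hwr : ∀ k, w k * r k = w (k + 1) := fun k => by
    change w k * ((1 + η) ^ (k - c).natAbs * w (k + 1)) = w (k + 1)
    rw [← mul_assoc, ← mul_pow, inv_mul_cancel₀ h0.ne', one_pow, one_mul]
  have hb : ∀ k, ‖(r k - 1) • ContinuousLinearMap.id ℝ 𝔼‖ ≤ η := fun k => by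
    rw [norm_smul, Real.norm_eq_abs]
    exact (mul_le_of_le_one_right (abs_nonneg _) ContinuousLinearMap.norm_id_le).trans (hr k)
  have hW : ∃ C, ∀ k, ‖w k • ContinuousLinearMap.id ℝ 𝔼‖ ≤ C := ⟨1, fun k => by
    rw [norm_smul, Real.norm_eq_abs, abs_of_pos (hw0 k)]
    exact mul_le_one₀ (hw1 k) (norm_nonneg _) ContinuousLinearMap.norm_id_le⟩
  let T : EllZero d →L[ℝ] EllZero d := leftShift d - nemitski a h.bounded
  -- Substituting `w ψ` for the response and dividing the equation at `k` by `w k` gives `ψ (k + 1)`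
  -- the coefficient `r k = w (k + 1) / w k`. The conjugated operator is thus `T + B`.
  let B : EllZero d →L[ℝ] EllZero d :=
    (nemitski (fun k => (r k - 1) • ContinuousLinearMap.id ℝ 𝔼) ⟨η, hb⟩).comp (leftShift d)
  have hB : ‖B‖ ≤ η := (ContinuousLinearMap.opNorm_comp_le _ _).trans
    ((mul_le_of_le_one_right (norm_nonneg _) norm_leftShift_le).trans (norm_nemitski_le _ hη.le hb))
  have hTR : ∀ φ, T (R φ) = φ := fun φ => by
    ext n : 1
    exact h.solves φ n
  have hRT : ∀ φ, R (T φ) = φ := fun φ => h.unique _ _ fun n => rfl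
  obtain ⟨R', hR', -⟩ := ContinuousLinearMap.exists_inverse_of_norm_mul_norm_sub_lt_one
    (T' := T + B) hTR hRT (by
      rw [sub_add_cancel_left, norm_neg]
      have := mul_le_mul_of_nonneg_left hB (norm_nonneg R)
      linarith)
  let ψ := R' (singleSeq c x)
  have hψ : T ψ + B ψ = singleSeq c x := hR' _
  have hψn : ‖ψ‖ ≤ 2 * ‖R‖ * ‖x‖ := by
    have e : ψ = R (singleSeq c x - B ψ) := by rw [← hψ, add_sub_cancel_right, hRT]
    have h1 : ‖ψ‖ ≤ ‖R‖ * (‖x‖ + η * ‖ψ‖) := by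
      conv_lhs => rw [e]
      refine (R.le_opNorm _).trans (mul_le_mul_of_nonneg_left ?_ (norm_nonneg _))
      exact (norm_sub_le _ _).trans (add_le_add (norm_singleSeq_le c x) (B.le_of_opNorm_le hB ψ))
    nlinarith [norm_nonneg ψ]
  -- The weight is `1` at `c`, so multiplication by `w` leaves the impulse at `c` unchanged.
  have hφ : R (singleSeq c x) = nemitski (fun k => w k • ContinuousLinearMap.id ℝ 𝔼) hW ψ := by
    refine h.unique _ _ fun n => ?_
    have h1 : ψ (n + 1) - a n (ψ n) + (r n - 1) • ψ (n + 1) = singleSeq c x n :=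
      congrArg (fun φ : EllZero d => φ n) hψ
    have h2 : w (n + 1) • ψ (n + 1) - a n (w n • ψ n) = w n • singleSeq c x n := by
      rw [← h1, map_smul, ← hwr n, mul_smul, ← smul_sub]
      congr 1
      module
    change w (n + 1) • ψ (n + 1) - a n (w n • ψ n) = _
    rw [h2, singleSeq_apply]
    split_ifs with hn
    · simp [w, hn]
    · simp
  rw [hφ]
  change ‖w k • ψ k‖ ≤ _
  rw [norm_smul, Real.norm_eq_abs, abs_of_pos (hw0 k)]
  have h3 := (ψ.norm_apply_le k).trans hψn
  calc w k * ‖ψ k‖ ≤ w k * (2 * ‖R‖ * ‖x‖) := by gcongr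
    _ ≤ w k * ((2 * ‖R‖ + 1) * ‖x‖) := by
        gcongr
        linarith
    _ = _ := by ring

/-- The operator sends `singleSeq n x` to `singleSeq (n - 1) x - singleSeq n (a n x)`; apply the
inverse. This moves an impulse one step along an orbit. -/
theorem apply_singleSeq_map (h : IsGreenOperator a R) (n : ℤ) (x : 𝔼) :
    R (singleSeq n (a n x)) = R (singleSeq (n - 1) x) - singleSeq n x := by
  refine h.unique _ _ fun k => ?_
  have h1 := h.solves (singleSeq (n - 1) x) k
  change R (singleSeq (n - 1) x) (k + 1) - singleSeq n x (k + 1) -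
    a k (R (singleSeq (n - 1) x) k - singleSeq n x k) = _
  rw [map_sub, sub_sub_sub_comm, h1]
  simp only [singleSeq_apply, ← eq_sub_iff_add_eq]
  by_cases hk : k = n
  · subst hk
    simp
  · simp [hk]

theorem transition_apply (h : IsGreenOperator a R) (n : ℤ) (m : ℕ) (x : 𝔼) :
    transition a n m (R (singleSeq (n - 1) x) n) = R (singleSeq (n - 1) x) (n + m) := by
  induction m with
  | zero => simp [transition]
  | succ m ih =>
    have h1 := h.solves (singleSeq (n - 1) x) (n + m)
    rw [singleSeq_of_ne (by omega), sub_eq_zero, add_assoc] at h1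
    rw [Nat.cast_succ, h1, ← ih]
    rfl

/-- Cutting the response `φ` off to `[n, ∞)` creates a single defect, the jump `φ n` seen by the
equation at `n - 1`. By uniqueness the truncated sequence is the response to that impulse. For `m =
0` this says that the Green projector is idempotent. -/
theorem apply_singleSeq_idem (h : IsGreenOperator a R) (n : ℤ) (x : 𝔼) (m : ℕ) :
    R (singleSeq (n - 1) (R (singleSeq (n - 1) x) n)) (n + m) =
      R (singleSeq (n - 1) x) (n + m) := by
  let φ := R (singleSeq (n - 1) x)
  let q : ℤ → 𝔼 →L[ℝ] 𝔼 := fun k => if n ≤ k then ContinuousLinearMap.id ℝ 𝔼 else 0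
  have hq : ∃ C, ∀ k, ‖q k‖ ≤ C := ⟨1, fun k => by
    by_cases hk : n ≤ k
    · simpa [q, hk] using ContinuousLinearMap.norm_id_le
    · simp [q, hk]⟩
  have h1 : R (singleSeq (n - 1) (φ n)) = nemitski q hq φ := by
    refine h.unique _ _ fun k => ?_
    have h2 := h.solves (singleSeq (n - 1) x) k
    change q (k + 1) (φ (k + 1)) - a k (q k (φ k)) = _
    rcases lt_trichotomy k (n - 1) with hk | hk | hk
    · have h3 : ¬ n ≤ k + 1 := by omega
      have h4 : ¬ n ≤ k := by omega
      simp [q, h3, h4, singleSeq_of_ne hk.ne]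
    · subst hk
      simp [q]
    · have h3 : n ≤ k + 1 := by omega
      have h4 : n ≤ k := by omega
      rw [singleSeq_of_ne hk.ne'] at h2 ⊢
      simpa [q, h3, h4] using h2
  have h2 := congrArg (fun ψ : EllZero d => ψ (n + m)) h1
  have h3 : n ≤ n + m := by omega
  simpa [q, h3] using h2

/-- Moving the impulse along the orbit of `x` changes the response at `n` only in the first step, by
`-x`. Decay of responses then bounds `x` by its own image, which is the expansion on the kernel of
the projector. -/
theorem apply_singleSeq_transition (h : IsGreenOperator a R) (n : ℤ) (m : ℕ) {x : 𝔼}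
    (hx : R (singleSeq (n - 1) x) n = 0) :
    R (singleSeq (n + m) (transition a n (m + 1) x)) n = -x := by
  induction m with
  | zero =>
    have h1 := congrArg (fun ψ : EllZero d => ψ n) (h.apply_singleSeq_map n x)
    simpa [transition, hx] using h1
  | succ m ih =>
    have e : transition a n (m + 1 + 1) x =
        a (n + (m + 1 : ℕ)) (transition a n (m + 1) x) := rfl
    rw [e, h.apply_singleSeq_map, ← ih]
    have e2 : n + ((m + 1 : ℕ) : ℤ) - 1 = n + m := by push_cast; ring
    rw [e2]
    rw [ZeroAtInftyContinuousMap.sub_apply, singleSeq_of_ne (by omega), sub_zero]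

/-- The projector onto the initial values at `n` of solutions which tend to zero at `+∞`. -/
noncomputable def _root_.greenProjector (R : EllZero d →L[ℝ] EllZero d) (n : ℤ) : 𝔼 →L[ℝ] 𝔼 :=
  (evalAt n).comp (R.comp (singleSeq (n - 1)))

theorem _root_.greenProjector_apply (n : ℤ) (x : 𝔼) :
    greenProjector R n x = R (singleSeq (n - 1) x) n := rfl

/-- If `φ ↦ φ (· + 1) - a φ` is invertible on `ℓ₀`, then `a` has an exponential dichotomy on `ℤ`. -/
theorem isDichotomy (h : IsGreenOperator a R) : IsDichotomy a (greenProjector R) univ := by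
  obtain ⟨C, α, hC, ⟨hα0, hα1⟩, hdecay⟩ := h.exists_decay
  have hinv : ∀ n x, greenProjector R (n + 1) (a n x) = a n (greenProjector R n x) := fun n x => by
    have h1 := h.solves (singleSeq (n - 1) x) n
    rw [singleSeq_of_ne (by omega), sub_eq_zero] at h1
    rw [greenProjector_apply, greenProjector_apply, add_sub_cancel_right, h.apply_singleSeq_map,
      ← h1]
    rw [ZeroAtInftyContinuousMap.sub_apply, singleSeq_of_ne (by omega), sub_zero]
  have hidem : ∀ n x, greenProjector R n (greenProjector R n x) = greenProjector R n x :=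
    fun n x => by
    simpa [greenProjector_apply] using h.apply_singleSeq_idem n x 0
  -- The impulse after `m + 1` steps sits at `n + m`, so only `α ^ m` is gained; the factor `1 / α`
  -- compensates.
  have hexp : ∀ n (m : ℕ) x, greenProjector R n x = 0 →
      ‖x‖ ≤ C / α * α ^ m * ‖transition a n m x‖ := by
    intro n m x hx
    cases m with
    | zero =>
      have : 1 ≤ C / α := by rw [le_div_iff₀ hα0]; linarith
      simpa [transition] using le_mul_of_one_le_left (norm_nonneg x) this
    | succ m =>
      have h1 := hdecay (n + m) (transition a n (m + 1) x) n
      rw [h.apply_singleSeq_transition n m hx, norm_neg] at h1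
      have e : (n - (n + m)).natAbs = m := by omega
      rw [e] at h1
      have e2 : C / α * α ^ (m + 1) = C * α ^ m := by
        rw [pow_succ]
        field_simp
      rwa [e2]
  refine ⟨fun n _ => ContinuousLinearMap.ext (hidem n), ⟨C, fun n _ => ?_⟩,
    fun n _ _ => ContinuousLinearMap.ext (hinv n), fun n _ _ => ⟨?_, ?_, ?_⟩,
    ⟨C / α, α, ?_, ⟨hα0, hα1⟩, fun n m _ _ x => ⟨?_, ?_⟩⟩⟩
  · refine ContinuousLinearMap.opNorm_le_bound _ (by linarith) fun x => ?_
    refine (hdecay (n - 1) x n).trans ?_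
    gcongr
    exact mul_le_of_le_one_right (by linarith) (pow_le_one₀ hα0.le hα1.le)
  · intro x hx
    change greenProjector R (n + 1) (a n x) = 0
    rw [hinv, (show greenProjector R n x = 0 from hx), map_zero]
  · intro x hx y hy hxy
    have hxy' : greenProjector R n (x - y) = 0 := (greenProjector R n).ker.sub_mem hx hy
    have h1 := hexp n 1 (x - y) hxy'
    have h2 : transition a n 1 (x - y) = 0 := by
      have : a (n + (0 : ℕ)) (x - y) = 0 := by simp [show a n x = a n y from hxy]
      exact this
    rw [h2, norm_zero, mul_zero] at h1
    exact sub_eq_zero.1 (norm_le_zero_iff.1 h1)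
  · intro z hz
    have hz' : R (singleSeq n z) (n + 1) = 0 := by
      simpa [greenProjector_apply] using (show greenProjector R (n + 1) z = 0 from hz)
    have h1 := h.solves (singleSeq n z) n
    rw [hz', zero_sub, singleSeq_self, ← map_neg] at h1
    -- As the response to `z` at `n` vanishes at `n + 1`, the equation at `n` shows that `a n` maps
    -- this vector to `z`. Evaluating `apply_singleSeq_map` at `n` puts it in the kernel.
    refine ⟨-R (singleSeq n z) n, ?_, h1⟩
    have h2 := h.apply_singleSeq_map n (-R (singleSeq n z) n)
    rw [h1] at h2
    have h3 := congrArg (fun ψ : EllZero d => ψ n) h2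
    have h4 : R (singleSeq n z) n =
      greenProjector R n (-R (singleSeq n z) n) - singleSeq n (-R (singleSeq n z) n) n := h3
    rw [singleSeq_self, sub_neg_eq_add, right_eq_add] at h4
    exact h4
  · rw [le_div_iff₀ hα0]
    linarith
  -- By idempotence the forward orbit of `greenProjector R n x` is itself the response to that
  -- vector placed at `n - 1`, so the bound involves the projected vector and not `x`.
  · have h1 := hdecay (n - 1) (greenProjector R n x) (n + m)
    have h2 := h.apply_singleSeq_idem n x m
    rw [← greenProjector_apply] at h2
    rw [h2, ← h.transition_apply, ← greenProjector_apply] at h1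
    refine h1.trans ?_
    have e : (n + m - (n - 1)).natAbs = m + 1 := by omega
    rw [e, pow_succ, mul_comm (α ^ m) α, ← mul_assoc]
    gcongr
    rw [le_div_iff₀ hα0]
    have h3 : α * α ≤ 1 := mul_le_one₀ hα1.le hα0.le hα1.le
    nlinarith
  · have h1 := hexp n m (x - greenProjector R n x) (by rw [map_sub, hidem, sub_self])
    have hK : 0 < C / α := by positivity
    calc 1 / (C / α) * (1 / α) ^ m * ‖x - greenProjector R n x‖
        ≤ 1 / (C / α) * (1 / α) ^ m *
          (C / α * α ^ m * ‖transition a n m (x - greenProjector R n x)‖) := by gcongr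
      _ = ‖transition a n m (x - greenProjector R n x)‖ := by
          rw [one_div_pow]
          field_simp

end IsGreenOperator

end Green

/-! ### Inverses of operator families and their perturbation. -/

theorem ContinuousLinearMap.exists_continuous_inverse {Λ X : Type*} [TopologicalSpace Λ]
    [NormedAddCommGroup X] [NormedSpace ℝ X] [CompleteSpace X] {T : Λ → X →L[ℝ] X}
    (hT : Continuous T) (h : ∀ l, ∃ R : X →L[ℝ] X, (∀ x, T l (R x) = x) ∧ ∀ x, R (T l x) = x) :
    ∃ R : Λ → X →L[ℝ] X, Continuous R ∧ (∀ l x, T l (R l x) = x) ∧ ∀ l x, R l (T l x) = x := by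
  have hu : ∀ l, IsUnit (T l) := fun l => by
    obtain ⟨R, h1, h2⟩ := h l
    exact ⟨⟨T l, R, ContinuousLinearMap.ext h1, ContinuousLinearMap.ext h2⟩, rfl⟩
  refine ⟨fun l => Ring.inverse (T l), ?_, fun l x => ?_, fun l x => ?_⟩
  · rw [continuous_iff_continuousAt]
    intro l
    have h1 := NormedRing.inverse_continuousAt (hu l).unit
    exact ContinuousAt.comp (f := T) h1 hT.continuousAt
  · exact congrArg (fun f => f x) (Ring.mul_inverse_cancel _ (hu l))
  · exact congrArg (fun f => f x) (Ring.inverse_mul_cancel _ (hu l))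

theorem ContinuousLinearMap.continuous_of_eventually_norm_sub_le {Λ X Y : Type*}
    [TopologicalSpace Λ] [NormedAddCommGroup X] [NormedSpace ℝ X] [NormedAddCommGroup Y]
    [NormedSpace ℝ Y] {N : Λ → X →L[ℝ] Y}
    (h : ∀ l₀, ∀ ε > 0, ∀ᶠ l in 𝓝 l₀, ‖N l - N l₀‖ ≤ ε) : Continuous N := by
  rw [continuous_iff_continuousAt]
  intro l₀
  rw [ContinuousAt, Metric.tendsto_nhds]
  intro ε hε
  filter_upwards [h l₀ (ε / 2) (half_pos hε)] with l hl
  rw [dist_eq_norm]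
  exact hl.trans_lt (half_lt_self hε)

theorem ContinuousLinearMap.continuous_const_sub {Λ X Y : Type*}
    [TopologicalSpace Λ] [NormedAddCommGroup X] [NormedSpace ℝ X] [NormedAddCommGroup Y]
    [NormedSpace ℝ Y] (S : X →L[ℝ] Y) {N : Λ → X →L[ℝ] Y} (hN : Continuous N) :
    Continuous fun l => S - N l :=
  continuous_const.sub hN

theorem ContinuousLinearMap.exists_inverse_sub_of_norm_sub_le {X : Type*}
    [NormedAddCommGroup X] [NormedSpace ℝ X] [CompleteSpace X] {S N N' R : X →L[ℝ] X}
    (hTR : ∀ x, (S - N) (R x) = x) (hRT : ∀ x, R ((S - N) x) = x) {C δ : ℝ} (hC : ‖R‖ ≤ C)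
    (hδ : ‖N' - N‖ ≤ δ) (h : C * δ < 1) :
    ∃ R' : X →L[ℝ] X, (∀ x, (S - N') (R' x) = x) ∧ ∀ x, R' ((S - N') x) = x := by
  refine exists_inverse_of_norm_mul_norm_sub_lt_one hTR hRT (lt_of_le_of_lt ?_ h)
  rw [sub_sub_sub_cancel_left]
  exact mul_le_mul hC hδ (norm_nonneg _) ((norm_nonneg _).trans hC)

theorem ContinuousLinearMap.exists_norm_le_of_continuous {Λ X Y : Type*}
    [TopologicalSpace Λ] [CompactSpace Λ] [NormedAddCommGroup X] [NormedSpace ℝ X]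
    [NormedAddCommGroup Y] [NormedSpace ℝ Y] {R : Λ → X →L[ℝ] Y} (hR : Continuous R) :
    ∃ C : ℝ, 0 ≤ C ∧ ∀ l, ‖R l‖ ≤ C := by
  obtain ⟨C, hC⟩ := (isCompact_range hR).isBounded.exists_norm_le
  exact ⟨|C|, abs_nonneg C, fun l => (hC _ ⟨l, rfl⟩).trans (le_abs_self C)⟩

/-! ### Roughness of dichotomies and existence of admissible pairs. -/

section Roughness

variable {Λ : Type*} [TopologicalSpace Λ] {d : ℕ}

local notation "𝔼" => EuclideanSpace ℝ (Fin d)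

theorem transition_congr {a b : ℤ → 𝔼 →L[ℝ] 𝔼} {I : Set ℤ} (hI : I.OrdConnected)
    (hab : ∀ n ∈ I, a n = b n) {n : ℤ} {m : ℕ} (hn : n ∈ I) (hm : n + m ∈ I) :
    transition a n m = transition b n m := by
  induction m with
  | zero => rfl
  | succ m ih =>
    have h1 : n + m ∈ I := hI.out hn hm ⟨by omega, by push_cast; omega⟩
    change (a (n + m)).comp (transition a n m) = (b (n + m)).comp (transition b n m)
    rw [hab _ h1, ih h1]

theorem IsDichotomy.congr_of_subset {a b P : ℤ → 𝔼 →L[ℝ] 𝔼} {I J : Set ℤ} (hI : I.OrdConnected)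
    (hIJ : I ⊆ J) (hab : ∀ n ∈ I, a n = b n) (h : IsDichotomy b P J) : IsDichotomy a P I where
  projector n hn := h.projector n (hIJ hn)
  bounded := h.bounded.imp fun _ hC n hn => hC n (hIJ hn)
  invariant n hn hn' := by
    rw [hab n hn]
    exact h.invariant n (hIJ hn) (hIJ hn')
  regular n hn hn' := by
    rw [hab n hn]
    exact h.regular n (hIJ hn) (hIJ hn')
  estimates := by
    obtain ⟨K, α, hK, hα, hest⟩ := h.estimates
    refine ⟨K, α, hK, hα, fun n m hn hm x => ?_⟩
    rw [transition_congr hI hab hn hm]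
    exact hest n m (hIJ hn) (hIJ hm) x

theorem nemitski_sub_nemitski {a b : ℤ → 𝔼 →L[ℝ] 𝔼} (ha : ∃ C, ∀ n, ‖a n‖ ≤ C)
    (hb : ∃ C, ∀ n, ‖b n‖ ≤ C) (hab : ∃ C, ∀ n, ‖(a - b) n‖ ≤ C) :
    nemitski a ha - nemitski b hb = nemitski (a - b) hab := by
  ext φ n : 2
  rfl

theorem norm_nemitski_sub_nemitski_le {a b : ℤ → 𝔼 →L[ℝ] 𝔼} (ha : ∃ C, ∀ n, ‖a n‖ ≤ C)
    (hb : ∃ C, ∀ n, ‖b n‖ ≤ C) {C : ℝ} (hC : 0 ≤ C) (hab : ∀ n, ‖a n - b n‖ ≤ C) :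
    ‖nemitski a ha - nemitski b hb‖ ≤ C := by
  rw [nemitski_sub_nemitski ha hb ⟨C, hab⟩]
  exact norm_nemitski_le _ hC hab

namespace LinearField

theorem add_toFun (A B : LinearField Λ d) (n : ℤ) (l : Λ) :
    (A + B).toFun n l = A.toFun n l + B.toFun n l := rfl

theorem continuous_toFun (A : LinearField Λ d) (n : ℤ) : Continuous (A.toFun n) :=
  A.equicontinuous.continuous n

theorem continuous_nemitski (A : LinearField Λ d) :
    Continuous fun l => nemitski (fun n => A.toFun n l) (A.bounded l) := by
  refine ContinuousLinearMap.continuous_of_eventually_norm_sub_le fun l₀ ε hε => ?_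
  filter_upwards [Metric.equicontinuousAt_iff_right.1 (A.equicontinuous l₀) ε hε] with l hl
  refine norm_nemitski_sub_nemitski_le _ _ hε.le fun n => ?_
  rw [← dist_eq_norm, dist_comm]
  exact (hl n).le

theorem continuous_operator (A : LinearField Λ d) : Continuous A.operator :=
  ContinuousLinearMap.continuous_const_sub (leftShift d) A.continuous_nemitski

/-- The inverses depend norm-continuously on the parameter, and each Green projector is a fixed
continuous linear expression in the inverse. -/
theorem hasDichotomy_of_inverse (B : LinearField Λ d)
    (h : ∀ l, ∃ R : EllZero d →L[ℝ] EllZero d,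
      (∀ φ, B.operator l (R φ) = φ) ∧ ∀ φ, R (B.operator l φ) = φ) : B.HasDichotomy univ := by
  obtain ⟨R, hR, h1, h2⟩ := ContinuousLinearMap.exists_continuous_inverse B.continuous_operator h
  refine ⟨fun l => greenProjector (R l), fun n _ => ?_, fun l =>
    (isGreenOperator_of_inverse (B.bounded l) (h1 l) (h2 l)).isDichotomy⟩
  exact continuous_const.clm_comp (hR.clm_comp continuous_const)

/-- A field which is uniformly close to a continuous family of hyperbolic matrices has an
exponential dichotomy on `ℤ`. -/
theorem exists_hasDichotomy_univ_of_close [CompactSpace Λ] {M : Λ → 𝔼 →L[ℝ] 𝔼}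
    (hM : Continuous M) (hyp : ∀ l, IsHyperbolic (M l)) :
    ∃ δ : ℝ, 0 < δ ∧ ∀ B : LinearField Λ d, (∀ n l, ‖B.toFun n l - M l‖ ≤ δ) →
      B.HasDichotomy univ := by
  let T : Λ → EllZero d →L[ℝ] EllZero d := fun l =>
    leftShift d - nemitski (fun _ => M l) ⟨‖M l‖, fun _ => le_rfl⟩
  have hT : Continuous T := by
    refine ContinuousLinearMap.continuous_const_sub (leftShift d) <|
      ContinuousLinearMap.continuous_of_eventually_norm_sub_le fun l₀ ε hε => ?_
    filter_upwards [Metric.tendsto_nhds.1 hM.continuousAt ε hε] with l hl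
    refine norm_nemitski_sub_nemitski_le _ _ hε.le fun n => ?_
    rw [← dist_eq_norm]
    exact hl.le
  obtain ⟨R, hR, h1, h2⟩ := ContinuousLinearMap.exists_continuous_inverse hT fun l => by
    obtain ⟨u, hu⟩ := (hyp l).isUnit_leftShift_sub
    have hu' : (u : EllZero d →L[ℝ] EllZero d) = T l := hu
    refine ⟨(u⁻¹ :), fun x => ?_, fun x => ?_⟩
    · rw [← hu']
      exact congrArg (fun f => f x) u.mul_inv
    · rw [← hu']
      exact congrArg (fun f => f x) u.inv_mul
  obtain ⟨C, hC0, hC⟩ := ContinuousLinearMap.exists_norm_le_of_continuous hR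
  have hδ : (0 : ℝ) < 1 / (C + 1) := by positivity
  -- Compactness of `Λ` makes `C` a common bound for all inverses, and `C / (C + 1) < 1` is the
  -- Neumann condition.
  refine ⟨1 / (C + 1), hδ, fun B hB => B.hasDichotomy_of_inverse fun l => ?_⟩
  refine ContinuousLinearMap.exists_inverse_sub_of_norm_sub_le (h1 l) (h2 l) (hC l)
    (norm_nemitski_sub_nemitski_le _ _ hδ.le fun n => hB n l) ?_
  rw [mul_one_div, div_lt_one (by positivity)]
  linarith

open Classical in
/-- The field which agrees with `B` on `I` and with `M` elsewhere. -/
noncomputable def piecewise (B : LinearField Λ d)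
    {M : Λ → EuclideanSpace ℝ (Fin d) →L[ℝ] EuclideanSpace ℝ (Fin d)}
    (hM : Continuous M) (I : Set ℤ) : LinearField Λ d where
  toFun n := if n ∈ I then B.toFun n else M
  equicontinuous l₀ := by
    rw [Metric.equicontinuousAt_iff_right]
    intro ε hε
    filter_upwards [Metric.equicontinuousAt_iff_right.1 (B.equicontinuous l₀) ε hε,
      Metric.tendsto_nhds.1 hM.continuousAt ε hε] with l h1 h2 n
    split_ifs
    · exact h1 n
    · rw [dist_comm]
      exact h2
  bounded l := by
    obtain ⟨C, hC⟩ := B.bounded l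
    refine ⟨max C ‖M l‖, fun n => ?_⟩
    split_ifs
    · exact (hC n).trans (le_max_left _ _)
    · exact le_max_right _ _

/-- Replacing `B` by `M` off `I` gives a field close to `M` everywhere, hence a dichotomy on `ℤ`.
Its restriction to `I` is one for `B`, since transitions inside an interval use only coefficients
from that interval. -/
theorem exists_hasDichotomy_of_close [CompactSpace Λ] {M : Λ → 𝔼 →L[ℝ] 𝔼}
    (hM : Continuous M) (hyp : ∀ l, IsHyperbolic (M l)) :
    ∃ δ : ℝ, 0 < δ ∧ ∀ (B : LinearField Λ d) (I : Set ℤ), I.OrdConnected →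
      (∀ n ∈ I, ∀ l, ‖B.toFun n l - M l‖ ≤ δ) → B.HasDichotomy I := by
  obtain ⟨δ, hδ, h⟩ := exists_hasDichotomy_univ_of_close hM hyp
  refine ⟨δ, hδ, fun B I hI hB => ?_⟩
  obtain ⟨P, hP, hPd⟩ := h (B.piecewise hM I) fun n l => by
    by_cases hn : n ∈ I
    · simpa [piecewise, hn] using hB n hn l
    · simpa [piecewise, hn] using hδ.le
  refine ⟨P, fun n _ => hP n trivial, fun l =>
    (hPd l).congr_of_subset hI (subset_univ I) fun n hn => ?_⟩
  simp [piecewise, hn]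

/-- The limit family is continuous as a uniform limit. Half of the admissible distance `δ` is spent
on the convergence of `A`, the other half on `D`. -/
theorem exists_hasDichotomy_of_tendstoUniformly [CompactSpace Λ] {F : Filter ℤ} [F.NeBot]
    (A : LinearField Λ d) {M : Λ → 𝔼 →L[ℝ] 𝔼} (hyp : ∀ l, IsHyperbolic (M l))
    (hA : TendstoUniformly A.toFun M F) :
    ∃ γ : ℝ, 0 < γ ∧ ∃ s ∈ F, ∀ (D : LinearField Λ d) (I : Set ℤ), I.OrdConnected → I ⊆ s →
      (∀ n ∈ I, ∀ l, ‖D.toFun n l‖ ≤ γ) → (A + D).HasDichotomy I := by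
  have hM : Continuous M := hA.continuous (Frequently.of_forall A.continuous_toFun)
  obtain ⟨δ, hδ, h⟩ := exists_hasDichotomy_of_close hM hyp
  refine ⟨δ / 2, half_pos hδ, _, Metric.tendstoUniformly_iff.1 hA (δ / 2) (half_pos hδ),
    fun D I hI hIs hD => h _ I hI fun n hn l => ?_⟩
  have h1 : dist (M l) (A.toFun n l) < δ / 2 := hIs hn l
  rw [dist_comm, dist_eq_norm] at h1
  rw [add_toFun, add_sub_right_comm]
  linarith [norm_add_le (A.toFun n l - M l) (D.toFun n l), hD n hn l]

theorem IsAsymptoticallyHyperbolic.exists_isDichotomyRadius [CompactSpace Λ] {A : LinearField Λ d}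
    (hA : A.IsAsymptoticallyHyperbolic) : ∃ γp γm : ℝ, A.IsDichotomyRadius γp γm := by
  obtain ⟨Mp, Mm, hp, hm, hAp, hAm⟩ := hA
  obtain ⟨γp, hγp, s, hs, hsD⟩ := exists_hasDichotomy_of_tendstoUniformly A hp hAp
  obtain ⟨γm, hγm, t, ht, htD⟩ := exists_hasDichotomy_of_tendstoUniformly A hm hAm
  obtain ⟨κs, hκs⟩ := mem_atTop_sets.1 hs
  obtain ⟨κt, hκt⟩ := mem_atBot_sets.1 ht
  refine ⟨γp, γm, hγp, hγm, fun D hD => ?_, fun D hD => ?_⟩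
  · obtain ⟨⟨κ, -, hκ⟩, -⟩ := hD
    exact ⟨max κ κs, hsD D _ ordConnected_Ici (fun n hn => hκs n ((le_max_right _ _).trans hn))
      fun n hn => hκ n ((le_max_left _ _).trans hn)⟩
  · obtain ⟨-, κ, -, hκ⟩ := hD
    exact ⟨min κ κt, htD D _ ordConnected_Iic (fun n hn => hκt n (le_trans hn (min_le_right _ _)))
      fun n hn => hκ n (le_trans hn (min_le_left _ _))⟩

end LinearField

end Roughness

/-- The point is that the range is closed. On a closed complement `D` of the kernel the operator is
injective with the same range, and that range has a finite-dimensional, hence closed, algebraic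
complement. For a bounded operator between Banach spaces this forces a closed range, so the
restriction `D → T.range` is a topological isomorphism. -/
theorem ContinuousLinearMap.isFredholm_of_range_sup_eq_top {X Y : Type*} [NormedAddCommGroup X]
    [NormedSpace ℝ X] [CompleteSpace X] [NormedAddCommGroup Y] [NormedSpace ℝ Y] [CompleteSpace Y]
    (T : X →L[ℝ] Y) [FiniteDimensional ℝ T.ker] (V : Submodule ℝ Y) [FiniteDimensional ℝ V]
    (hV : T.range ⊔ V = ⊤) : T.IsFredholm := by
  have hco : T.range.CoFG := by
    refine Module.Finite.of_surjective (T.range.mkQ.comp V.subtype) ?_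
    rw [← LinearMap.range_eq_top, LinearMap.range_comp, Submodule.range_subtype]
    refine eq_top_iff.2 fun y _ => ?_
    obtain ⟨y, rfl⟩ := T.range.mkQ_surjective y
    obtain ⟨x, hx, v, hv, rfl⟩ := Submodule.mem_sup.1 (hV.ge (Submodule.mem_top (x := y)))
    exact ⟨v, hv, by simpa using hx⟩
  obtain ⟨D, hD⟩ := (Submodule.ClosedComplemented.of_finiteDimensional T.ker).exists_isTopCompl
  have hDc : IsClosed (D : Set X) := hD.symm.isClosed
  have : CompleteSpace D := hDc.completeSpace_coe
  obtain ⟨C, hC⟩ := T.range.exists_isCompl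
  have : FiniteDimensional ℝ C := .of_fg (hco.fg_of_isCompl hC)
  let S : D →L[ℝ] Y := T.comp D.subtypeL
  have hSinj : S.ker = ⊥ := by
    rw [Submodule.eq_bot_iff]
    intro x hx
    exact Subtype.ext (Submodule.disjoint_def.1 hD.isCompl.disjoint x hx x.2)
  have hSrange : S.range = T.range := by
    refine le_antisymm (LinearMap.range_comp_le_range _ _) ?_
    rintro _ ⟨x, rfl⟩
    obtain ⟨k, hk, y, hy, rfl⟩ := Submodule.mem_sup.1
      (hD.isCompl.sup_eq_top.ge (Submodule.mem_top (x := x)))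
    exact ⟨⟨y, hy⟩, by simpa [S] using hk⟩
  have hclosed : IsClosed (T.range : Set Y) := by
    rw [← hSrange] at hC ⊢
    exact S.closed_complemented_range_of_isCompl_of_ker_eq_bot C hC
      (Submodule.closed_of_finiteDimensional C) hSinj
  have : CompleteSpace T.range := hclosed.completeSpace_coe
  have hmaps : MapsTo T D T.range := fun x _ => ⟨x, rfl⟩
  have : D.CoFG := by
    have := Submodule.quotientEquivOfIsCompl D T.ker hD.isCompl.symm
    exact Module.Finite.equiv this.symm
  refine IsFredholm.of_isInvertible_restrict hDc hclosed hmaps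
    ⟨ContinuousLinearEquiv.ofBijective (T.restrict hmaps) ?_ ?_, ?_⟩
  · rw [Submodule.eq_bot_iff]
    intro x hx
    have hx' : S x = 0 := congrArg Subtype.val (show T.restrict hmaps x = 0 from hx)
    exact (Submodule.eq_bot_iff _).1 hSinj x hx'
  · refine eq_top_iff.2 fun y _ => ?_
    obtain ⟨x, hx⟩ := hSrange.ge y.2
    exact ⟨x, Subtype.ext hx⟩
  · exact ContinuousLinearEquiv.coe_ofBijective _ _ _

/-! ### From dichotomies on two half-lines to the Fredholm property. -/

section HalfLine

variable {d : ℕ}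

local notation "𝔼" => EuclideanSpace ℝ (Fin d)

theorem transition_succ_apply (a : ℤ → 𝔼 →L[ℝ] 𝔼) (n : ℤ) (m : ℕ) (x : 𝔼) :
    transition a n (m + 1) x = a (n + m) (transition a n m x) := rfl

theorem transition_succ_apply' (a : ℤ → 𝔼 →L[ℝ] 𝔼) (n : ℤ) (m : ℕ) (x : 𝔼) :
    transition a n (m + 1) x = transition a (n + 1) m (a n x) := by
  induction m with
  | zero => simp [transition]
  | succ m ih =>
    rw [transition_succ_apply, ih, transition_succ_apply]
    congr 2
    push_cast
    ring

theorem transition_apply_of_solution {a : ℤ → 𝔼 →L[ℝ] 𝔼} {φ : ℤ → 𝔼}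
    (hφ : ∀ n, φ (n + 1) = a n (φ n)) (n : ℤ) (m : ℕ) : transition a n m (φ n) = φ (n + m) := by
  induction m with
  | zero => simp [transition]
  | succ m ih => rw [transition_succ_apply, ih, ← hφ, Nat.cast_succ, add_assoc]

theorem summable_pow_natAbs {α : ℝ} (hα : α ∈ Ioo (0 : ℝ) 1) :
    Summable fun j : ℤ => α ^ j.natAbs := by
  have h := summable_geometric_of_lt_one hα.1.le hα.2
  refine Summable.of_nat_of_neg ?_ ?_
  · simpa using h
  · simpa using h

namespace IsDichotomy

variable {a P : ℤ → EuclideanSpace ℝ (Fin d) →L[ℝ] EuclideanSpace ℝ (Fin d)} {I : Set ℤ}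

theorem projector_apply (h : IsDichotomy a P I) {n : ℤ} (hn : n ∈ I) (x : 𝔼) :
    P n (P n x) = P n x :=
  congrArg (fun f => f x) (h.projector n hn)

theorem invariant_apply (h : IsDichotomy a P I) {n : ℤ} (hn : n ∈ I) (hn' : n + 1 ∈ I) (x : 𝔼) :
    P (n + 1) (a n x) = a n (P n x) :=
  congrArg (fun f => f x) (h.invariant n hn hn')

theorem projector_transition (h : IsDichotomy a P I) (hI : I.OrdConnected) {n : ℤ} {m : ℕ}
    (hn : n ∈ I) (hm : n + m ∈ I) (x : 𝔼) :
    P (n + m) (transition a n m x) = transition a n m (P n x) := by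
  induction m with
  | zero => simp [transition]
  | succ m ih =>
    have h1 : n + m ∈ I := hI.out hn hm ⟨by omega, by push_cast; omega⟩
    rw [Nat.cast_succ, ← add_assoc] at hm
    rw [Nat.cast_succ, ← add_assoc, transition_succ_apply, h.invariant_apply h1 hm, ih h1,
      transition_succ_apply]

theorem eq_zero_of_transition_eq_zero (h : IsDichotomy a P I) {n : ℤ} {m : ℕ}
    (hn : n ∈ I) (hm : n + m ∈ I) {x : 𝔼} (hx : P n x = 0) (h0 : transition a n m x = 0) :
    x = 0 := by
  obtain ⟨K, α, hK, ⟨hα0, -⟩, hest⟩ := h.estimates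
  have h1 := (hest n m hn hm x).2
  rw [hx, sub_zero, h0, norm_zero] at h1
  have h2 : 0 < 1 / K * (1 / α) ^ m := by positivity
  exact norm_le_zero_iff.1 (nonpos_of_mul_nonpos_right h1 h2)

theorem exists_transition_eq (h : IsDichotomy a P I) (hI : I.OrdConnected) {n : ℤ} {m : ℕ}
    (hn : n ∈ I) (hm : n + m ∈ I) {y : 𝔼} (hy : P (n + m) y = 0) :
    ∃ v, P n v = 0 ∧ transition a n m v = y := by
  induction m generalizing y with
  | zero => exact ⟨y, by simpa using hy, rfl⟩
  | succ m ih =>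
    have h1 : n + m ∈ I := hI.out hn hm ⟨by omega, by push_cast; omega⟩
    rw [Nat.cast_succ, ← add_assoc] at hm hy
    obtain ⟨z, hz, rfl⟩ := (h.regular (n + m) h1 hm).surjOn hy
    obtain ⟨v, hv, rfl⟩ := ih h1 hz
    exact ⟨v, hv, rfl⟩

/-- The summands of the Green function of a dichotomy. -/
theorem exists_greenSummand (h : IsDichotomy a P I) (hI : I.OrdConnected) (f : ℤ → 𝔼) (n k : ℤ) :
    ∃ v : 𝔼, (¬ (n ∈ I ∧ k ∈ I ∧ k + 1 ∈ I) → v = 0) ∧ (n ∈ I ∧ k ∈ I ∧ k + 1 ∈ I →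
      (∀ m : ℕ, n = k + 1 + m → v = transition a (k + 1) m (P (k + 1) (f k))) ∧
      ∀ m : ℕ, k = n + m → P n v = 0 ∧
        transition a n (m + 1) v = -(f k - P (k + 1) (f k))) := by
  by_cases hJ : n ∈ I ∧ k ∈ I ∧ k + 1 ∈ I
  -- For `k < n` the summand carries `P (k + 1) (f k)` forward to `n`. For `k ≥ n` it is the vector
  -- in the kernel of `P n` that the dynamics carries to minus the complementary part of `f k`, so
  -- no inverse of the restricted transition has to be named.
  · rcases lt_or_ge k n with hkn | hkn
    · obtain ⟨m, rfl⟩ : ∃ m : ℕ, n = k + 1 + m := ⟨(n - (k + 1)).toNat, by omega⟩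
      refine ⟨transition a (k + 1) m (P (k + 1) (f k)), fun h' => absurd hJ h',
        fun _ => ⟨fun m' hm' => ?_, fun m' hm' => by omega⟩⟩
      obtain rfl : m = m' := by omega
      rfl
    · obtain ⟨m, rfl⟩ : ∃ m : ℕ, k = n + m := ⟨(k - n).toNat, by omega⟩
      have e : n + ((m + 1 : ℕ) : ℤ) = n + m + 1 := by push_cast; ring
      obtain ⟨v, hv, hv'⟩ := h.exists_transition_eq hI (n := n) (m := m + 1)
        (y := -(f (n + m) - P (n + m + 1) (f (n + m)))) hJ.1 (by rw [e]; exact hJ.2.2) (by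
          rw [e, map_neg, map_sub, h.projector_apply hJ.2.2, sub_self, neg_zero])
      refine ⟨v, fun h' => absurd hJ h', fun _ => ⟨fun m' hm' => by omega, fun m' hm' => ?_⟩⟩
      obtain rfl : m = m' := by omega
      exact ⟨hv, hv'⟩
  · exact ⟨0, fun _ => rfl, fun h' => absurd h' hJ⟩

/-- The inhomogeneous equation with right-hand side in `ℓ₀` has a solution in `ℓ₀` on an interval
on which there is an exponential dichotomy. -/
theorem exists_solution (h : IsDichotomy a P I) (hI : I.OrdConnected) (f : EllZero d) :
    ∃ φ : EllZero d, (∀ n, n ∉ I → φ n = 0) ∧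
      ∀ n, n ∈ I → n + 1 ∈ I → φ (n + 1) = a n (φ n) + f n := by
  choose g hg0 hg using h.exists_greenSummand hI f
  obtain ⟨K, α, hK, ⟨hα0, hα1⟩, hest⟩ := h.estimates
  obtain ⟨C, hC⟩ := h.bounded
  -- `1 + |C|` bounds both `P` and its complement. Division by `α` is for the forward summands: they
  -- make one step fewer than the exponent `|k - n|` indicates.
  let B : ℝ := K * (1 + |C|) / α
  have hB : 0 ≤ B := by positivity
  have hPC : ∀ n ∈ I, ∀ x, ‖P n x‖ ≤ |C| * ‖x‖ := fun n hn x =>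
    (P n).le_of_opNorm_le ((hC n hn).trans (le_abs_self C)) x
  have hgn : ∀ n k, ‖g n k‖ ≤ B * α ^ (k - n).natAbs * ‖f k‖ := by
    intro n k
    by_cases hJ : n ∈ I ∧ k ∈ I ∧ k + 1 ∈ I
    swap
    · rw [hg0 n k hJ, norm_zero]
      positivity
    obtain ⟨h1, h2⟩ := hg n k hJ
    rcases lt_or_ge k n with hkn | hkn
    · obtain ⟨m, rfl⟩ : ∃ m : ℕ, n = k + 1 + m := ⟨(n - (k + 1)).toNat, by omega⟩
      rw [h1 m rfl]
      refine ((hest (k + 1) m hJ.2.2 hJ.1 _).1).trans ?_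
      have e : (k - (k + 1 + m)).natAbs = m + 1 := by omega
      rw [e]
      have e2 : B * α ^ (m + 1) = K * α ^ m * (1 + |C|) := by
        simp only [B, pow_succ]
        field_simp
      rw [e2, mul_assoc _ (1 + |C|)]
      gcongr
      refine (hPC _ hJ.2.2 _).trans ?_
      gcongr
      linarith
    · obtain ⟨m, rfl⟩ : ∃ m : ℕ, k = n + m := ⟨(k - n).toNat, by omega⟩
      obtain ⟨h3, h4⟩ := h2 m rfl
      have e0 : n + ((m + 1 : ℕ) : ℤ) = n + m + 1 := by push_cast; ring
      have h5 := (hest n (m + 1) hJ.1 (by rw [e0]; exact hJ.2.2) (g n (n + m))).2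
      rw [h3, sub_zero, h4, norm_neg] at h5
      have h6 : ‖f (n + m) - P (n + m + 1) (f (n + m))‖ ≤ (1 + |C|) * ‖f (n + m)‖ := by
        refine (norm_sub_le _ _).trans ?_
        linarith [hPC _ hJ.2.2 (f (n + m))]
      have e : (n + m - n).natAbs = m := by omega
      rw [e]
      calc ‖g n (n + m)‖
          = K * α ^ (m + 1) * (1 / K * (1 / α) ^ (m + 1) * ‖g n (n + m)‖) := by
            rw [one_div_pow]
            field_simp
        _ ≤ K * α ^ (m + 1) * ((1 + |C|) * ‖f (n + m)‖) := by
            exact mul_le_mul_of_nonneg_left (h5.trans h6) (by positivity)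
        _ = α ^ 2 * (B * α ^ m * ‖f (n + m)‖) := by
            simp only [B, pow_succ]
            field_simp
        _ ≤ 1 * (B * α ^ m * ‖f (n + m)‖) := by
            gcongr
            exact pow_le_one₀ hα0.le hα1.le
        _ = _ := one_mul _
  have hbound : ∀ n j, ‖g n (n + j)‖ ≤ B * ‖f‖ * α ^ j.natAbs := fun n j => by
    refine (hgn n (n + j)).trans ?_
    rw [add_sub_cancel_left, mul_right_comm]
    gcongr
    exact f.norm_apply_le _
  have hsumm : Summable fun j : ℤ => B * ‖f‖ * α ^ j.natAbs :=
    (summable_pow_natAbs ⟨hα0, hα1⟩).mul_left _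
  have hs : ∀ n, Summable (g n) := fun n =>
    ((Equiv.addLeft n).summable_iff (f := g n)).1 (hsumm.of_norm_bounded (hbound n))
  have hlim : Tendsto (fun n => ∑' k, g n k) (cocompact ℤ) (𝓝 0) := by
    -- Reindexing by `k = n + j` makes the summable majorant independent of `n`, while each term
    -- tends to zero with `f (n + j)`.
    have h1 : Tendsto (fun n => ∑' j, g n (n + j)) (cocompact ℤ) (𝓝 (∑' _ : ℤ, (0 : 𝔼))) := by
      refine tendsto_tsum_of_dominated_convergence hsumm (fun j => ?_)
        (Eventually.of_forall fun n j => hbound n j)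
      have h2 : Tendsto (fun n => f (n + j)) (cocompact ℤ) (𝓝 0) :=
        f.zero_at_infty'.comp (Homeomorph.addRight j).isClosedEmbedding.tendsto_cocompact
      refine squeeze_zero_norm (a := fun n => B * α ^ j.natAbs * ‖f (n + j)‖) (fun n => ?_) ?_
      · simpa using hgn n (n + j)
      · simpa using h2.norm.const_mul (B * α ^ j.natAbs)
    rw [tsum_zero] at h1
    exact h1.congr fun n => (Equiv.addLeft n).tsum_eq (g n)
  let φ : EllZero d := ⟨⟨fun n => ∑' k, g n k, continuous_of_discreteTopology⟩, hlim⟩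
  refine ⟨φ, fun n hn => ?_, fun n hn hn' => ?_⟩
  · change ∑' k, g n k = 0
    simp [fun k => hg0 n k fun h' => hn h'.1]
  -- Each summand solves the homogeneous equation except at `k = n`, where the change from the
  -- backward to the forward branch adds both parts of `f n`. For `k > n` the two sides lie in the
  -- kernel at `n + 1` and have the same image under a transition injective there.
  have hrec : ∀ k, g (n + 1) k = a n (g n k) + if k = n then f n else 0 := by
    intro k
    by_cases hJ : k ∈ I ∧ k + 1 ∈ I
    swap
    · have hk : k ≠ n := by
        rintro rfl
        exact hJ ⟨hn, hn'⟩
      rw [hg0 n k fun h' => hJ h'.2, hg0 (n + 1) k fun h' => hJ h'.2, if_neg hk, map_zero, add_zero]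
    obtain ⟨h1, h2⟩ := hg n k ⟨hn, hJ⟩
    obtain ⟨h1', h2'⟩ := hg (n + 1) k ⟨hn', hJ⟩
    rcases lt_trichotomy k n with hkn | rfl | hkn
    · obtain ⟨m, rfl⟩ : ∃ m : ℕ, n = k + 1 + m := ⟨(n - (k + 1)).toNat, by omega⟩
      rw [if_neg hkn.ne, add_zero, h1 m rfl, h1' (m + 1) (by push_cast; ring)]
      rfl
    · have h3 := (h2 0 (by simp)).2
      have h4 := h1' 0 (by simp)
      rw [transition_succ_apply, Nat.cast_zero, add_zero] at h3
      rw [h4, if_pos rfl]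
      change P (k + 1) (f k) = _
      rw [show a k (g k k) = _ from h3]
      abel
    · obtain ⟨m, rfl⟩ : ∃ m : ℕ, k = n + 1 + m := ⟨(k - (n + 1)).toNat, by omega⟩
      obtain ⟨h3, h4⟩ := h2 (m + 1) (by push_cast; ring)
      obtain ⟨h3', h4'⟩ := h2' m rfl
      rw [if_neg hkn.ne', add_zero, ← sub_eq_zero]
      have e0 : n + 1 + ((m + 1 : ℕ) : ℤ) = n + 1 + m + 1 := by push_cast; ring
      refine h.eq_zero_of_transition_eq_zero (m := m + 1) hn' (by rw [e0]; exact hJ.2) ?_ ?_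
      · rw [map_sub, h3', h.invariant_apply hn hn', h3, map_zero, sub_zero]
      · rw [map_sub, h4', ← transition_succ_apply', h4, sub_self]
  change ∑' k, g (n + 1) k = a n (∑' k, g n k) + f n
  rw [tsum_congr hrec, Summable.tsum_add, tsum_ite_eq, (a n).map_tsum (hs n)]
  · exact (hs n).mapL (a n)
  · exact (hasSum_ite_eq n (f n)).summable

/-- The component `P n (φ n)` is the forward image of bounded components from arbitrarily far left,
so contraction makes it vanish. Hence `φ n` lies in the kernel of `P n`, where transitions are
injective, and `φ κ = 0` propagates to the left; to the right it propagates by the recursion.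
Evaluation at `κ` is thus injective on null solutions. -/
theorem eq_zero_of_solution {κ : ℤ} (h : IsDichotomy a P (Iic κ)) {φ : EllZero d}
    (hφ : ∀ n, φ (n + 1) = a n (φ n)) (hκ : φ κ = 0) : φ = 0 := by
  obtain ⟨K, α, hK, ⟨hα0, hα1⟩, hest⟩ := h.estimates
  obtain ⟨C, hC⟩ := h.bounded
  have hP : ∀ n ≤ κ, P n (φ n) = 0 := by
    intro n hn
    have hb : ∀ m : ℕ, ‖P n (φ n)‖ ≤ K * (|C| * ‖φ‖) * α ^ m := by
      intro m
      have h1 : n - m ∈ Iic κ := by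
        change n - m ≤ κ
        omega
      have e : n - m + m = n := sub_add_cancel _ _
      have h2 := h.projector_transition ordConnected_Iic h1 (by rwa [e]) (φ (n - m))
      rw [transition_apply_of_solution hφ, e] at h2
      have h3 := (hest (n - m) m h1 (by rwa [e]) (φ (n - m))).1
      rw [h2, mul_right_comm]
      refine h3.trans ?_
      gcongr
      refine ((P (n - m)).le_of_opNorm_le ((hC _ h1).trans (le_abs_self C)) _).trans ?_
      gcongr
      exact φ.norm_apply_le _
    have hlim : Tendsto (fun m : ℕ => K * (|C| * ‖φ‖) * α ^ m) atTop (𝓝 0) := by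
      simpa using (tendsto_pow_atTop_nhds_zero_of_lt_one hα0.le hα1).const_mul (K * (|C| * ‖φ‖))
    exact norm_le_zero_iff.1 (ge_of_tendsto' hlim hb)
  ext n : 1
  rcases le_total n κ with hn | hn
  · obtain ⟨m, rfl⟩ : ∃ m : ℕ, κ = n + m := ⟨(κ - n).toNat, by omega⟩
    exact h.eq_zero_of_transition_eq_zero (m := m) hn (mem_Iic.2 le_rfl) (hP n hn)
      ((transition_apply_of_solution hφ n m).trans hκ)
  · obtain ⟨m, rfl⟩ : ∃ m : ℕ, n = κ + m := ⟨(n - κ).toNat, by omega⟩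
    rw [← transition_apply_of_solution hφ κ m, hκ, map_zero]
    rfl

end IsDichotomy

theorem mem_sup_range_singleSeq {φ : EllZero d} (F : Finset ℤ) (h : ∀ n ∉ F, φ n = 0) :
    φ ∈ F.sup fun k => (singleSeq (d := d) k).range := by
  have e : φ = ∑ k ∈ F, singleSeq k (φ k) := by
    ext n : 1
    have h1 : (∑ k ∈ F, singleSeq k (φ k)) n = ∑ k ∈ F, singleSeq k (φ k) n :=
      map_sum (evalAt n) _ _
    rw [h1]
    simp only [singleSeq_apply, Finset.sum_ite_eq]
    split_ifs with hn
    · rfl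
    · exact h n hn
  rw [e]
  exact Submodule.sum_mem _ fun k hk =>
    Finset.le_sup (f := fun k => (singleSeq (d := d) k).range) hk ⟨φ k, rfl⟩

/-- A sequence of matrices with exponential dichotomies on both half-lines defines a Fredholm
operator. -/
theorem isFredholm_of_isDichotomy {a P Q : ℤ → 𝔼 →L[ℝ] 𝔼} (ha : ∃ C, ∀ n, ‖a n‖ ≤ C) {κ κ' : ℤ}
    (hP : IsDichotomy a P (Ici κ)) (hQ : IsDichotomy a Q (Iic κ')) :
    (leftShift d - nemitski a ha).IsFredholm := by
  let T : EllZero d →L[ℝ] EllZero d := leftShift d - nemitski a ha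
  have hT : ∀ φ n, T φ n = φ (n + 1) - a n (φ n) := fun _ _ => rfl
  have hker : FiniteDimensional ℝ T.ker := by
    refine FiniteDimensional.of_injective ((evalAt κ').toLinearMap.comp T.ker.subtype) ?_
    refine (injective_iff_map_eq_zero _).2 fun φ hφ => ?_
    refine Subtype.ext (hQ.eq_zero_of_solution (fun n => ?_) hφ)
    have h1 : T φ = 0 := φ.2
    rw [← sub_eq_zero, ← hT, h1]
    rfl
  have hF : ∀ F : Finset ℤ, FiniteDimensional ℝ
      ↥(F.sup fun k => (singleSeq (d := d) k).range) := fun F =>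
    Submodule.finiteDimensional_finset_sup F _
  -- With `κ' ≤ κ₁` the half-lines share at most one point. The zero extensions of the two solutions
  -- then interfere only at indices in `[κ' - 1, κ₁]`; the left end accounts for `φ (n + 1)` in the
  -- equation at `n`.
  let κ₁ := max κ κ'
  have hκ : κ' ≤ κ₁ := le_max_right _ _
  have hP' : IsDichotomy a P (Ici κ₁) := hP.congr_of_subset ordConnected_Ici
    (Ici_subset_Ici.2 (le_max_left _ _)) fun _ _ => rfl
  refine T.isFredholm_of_range_sup_eq_top
    ((Finset.Icc (κ' - 1) κ₁).sup fun k => (singleSeq (d := d) k).range)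
    (eq_top_iff.2 fun f _ => ?_)
  obtain ⟨φ, hφ0, hφ⟩ := hP'.exists_solution ordConnected_Ici f
  obtain ⟨ψ, hψ0, hψ⟩ := hQ.exists_solution ordConnected_Iic f
  have h1 : f - T (φ + ψ) ∈ (Finset.Icc (κ' - 1) κ₁).sup fun k => (singleSeq (d := d) k).range := by
    refine mem_sup_range_singleSeq _ fun n hn => ?_
    rw [Finset.mem_Icc, not_and_or, not_le, not_le] at hn
    rw [map_add]
    change f n - (T φ n + T ψ n) = 0
    rw [hT, hT]
    rcases hn with hn | hn
    · rw [hφ0 n (by simp only [mem_Ici]; omega), hφ0 (n + 1) (by simp only [mem_Ici]; omega),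
        hψ n (by simp only [mem_Iic]; omega) (by simp only [mem_Iic]; omega)]
      simp
    · rw [hψ0 n (by simp only [mem_Iic]; omega), hψ0 (n + 1) (by simp only [mem_Iic]; omega),
        hφ n (by simp only [mem_Ici]; omega) (by simp only [mem_Ici]; omega)]
      simp
  have h2 := Submodule.add_mem_sup (LinearMap.mem_range_self T.toLinearMap (φ + ψ)) h1
  simpa using h2

end HalfLine

/-! ### Homotopy invariance of the index bundle. -/

section Homotopy

universe u

variable {Λ : Type u} [TopologicalSpace Λ] {X Y : Type}
  [NormedAddCommGroup X] [NormedSpace ℝ X] [NormedAddCommGroup Y] [NormedSpace ℝ Y]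
  [CompactSpace Λ] [T2Space Λ] [ConnectedSpace Λ] [CompleteSpace X] [CompleteSpace Y]

/-- A continuous family of isomorphisms which matches the fibres is an isomorphism of kernel
bundles. -/
theorem nonempty_kernelBundle_iso {L L' : Λ → X →L[ℝ] Y} (hL : IsFredholmFamily L)
    (hL' : IsFredholmFamily L') {V : Submodule ℝ Y} (hV : IsTransversal L V)
    (hV' : IsTransversal L' V) {g g' : Λ → X →L[ℝ] X} (hg : Continuous g) (hg' : Continuous g')
    (hgg' : ∀ l x, g l (g' l x) = x) (hg'g : ∀ l x, g' l (g l x) = x)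
    (hm : ∀ l x, L l x ∈ V → L' l (g l x) ∈ V) (hm' : ∀ l x, L' l x ∈ V → L l (g' l x) ∈ V) :
    Nonempty (RealVectorBundle.Iso (kernelBundle hL hV) (kernelBundle hL' hV')) := by
  let φ : ∀ l, (V.comap (L l).toLinearMap) ≃ₗ[ℝ] (V.comap (L' l).toLinearMap) := fun l =>
    { toFun := fun x => ⟨g l x, hm l x x.2⟩
      map_add' := fun x y => by ext; simp
      map_smul' := fun c x => by ext; simp
      invFun := fun x => ⟨g' l x, hm' l x x.2⟩
      left_inv := fun x => Subtype.ext (hg'g l x)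
      right_inv := fun x => Subtype.ext (hgg' l x) }
  have h1 := (kernelBundle_continuous_iff hL hV).1 continuous_id
  have h2 := (kernelBundle_continuous_iff hL' hV').1 continuous_id
  refine ⟨⟨φ, (kernelBundle_continuous_iff hL' hV').2 ?_,
    (kernelBundle_continuous_iff hL hV).2 ?_⟩⟩
  · exact h1.fst.prodMk ((hg.comp h1.fst).clm_apply h1.snd)
  · exact h2.fst.prodMk ((hg'.comp h2.fst).clm_apply h2.snd)

/-- Nearby families of idempotents are conjugate. -/
theorem eventually_exists_conjugation {Z 𝔸 : Type*} [TopologicalSpace Z] [NormedRing 𝔸]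
    [CompleteSpace 𝔸] {q : Z → 𝔸} (hq : Continuous q) (hqq : ∀ z, q z * q z = q z) (z₀ : Z) :
    ∀ᶠ z in 𝓝 z₀, ∃ u : 𝔸ˣ, (u : 𝔸) * q z₀ = q z * u ∧
      q z₀ * (u⁻¹ : 𝔸ˣ) = (u⁻¹ : 𝔸ˣ) * q z := by
  -- `G z` intertwines the idempotents, as `G z * q z₀ = q z * q z₀ = q z * G z`. It equals `1` at
  -- `z₀`, hence is a unit nearby.
  let G : Z → 𝔸 := fun z => q z * q z₀ + (1 - q z) * (1 - q z₀)
  have hG : Continuous G := by fun_prop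
  have hG0 : G z₀ = 1 := by
    simp only [G, mul_sub, sub_mul, hqq, mul_one, one_mul]
    abel
  have hU : {z | IsUnit (G z)} ∈ 𝓝 z₀ :=
    (Units.isOpen.preimage hG).mem_nhds (by simp [hG0])
  filter_upwards [hU] with z hz
  obtain ⟨u, hu⟩ := hz
  have key : (u : 𝔸) * q z₀ = q z * u → (u : 𝔸) * q z₀ = q z * u ∧
      q z₀ * (u⁻¹ : 𝔸ˣ) = (u⁻¹ : 𝔸ˣ) * q z := fun h => ⟨h, by
    rw [Units.eq_inv_mul_iff_mul_eq, ← mul_assoc, h, mul_assoc, Units.mul_inv, mul_one]⟩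
  refine ⟨u, key ?_⟩
  rw [hu]
  have h1 : (1 - q z₀) * q z₀ = 0 := by rw [sub_mul, one_mul, hqq, sub_self]
  have h2 : q z * (1 - q z) = 0 := by rw [mul_sub, mul_one, hqq, sub_self]
  simp only [G]
  rw [add_mul, mul_add, mul_assoc, hqq, mul_assoc, h1, mul_zero, ← mul_assoc, hqq, ← mul_assoc, h2,
    zero_mul]

/-- Homotopy invariance of the index bundle. -/
theorem indexBundle_eq_of_homotopy {F : unitInterval → Λ → X →L[ℝ] Y}
    (hF : IsFredholmFamily fun p : unitInterval × Λ => F p.1 p.2)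
    (h : ∀ t, IsFredholmFamily (F t)) (s t : unitInterval) :
    indexBundle (h s) = indexBundle (h t) := by
  obtain ⟨V, hV⟩ := exists_isTransversal hF
  have hVt : ∀ t, IsTransversal (F t) V := fun t => ⟨hV.finite, fun l => hV.sup_eq_top (t, l)⟩
  obtain ⟨p, hp, hpV, hpx⟩ := hV.exists_proj_comap hF
  -- Conjugating in the algebra of continuous families, rather than at each point of `Λ`, yields at
  -- once an intertwiner and an inverse that are continuous in the parameter.
  let q : unitInterval → C(Λ, X →L[ℝ] X) := (ContinuousMap.curry ⟨p, hp⟩)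
  have hq : Continuous q := (ContinuousMap.curry ⟨p, hp⟩).continuous
  have hqq : ∀ t, q t * q t = q t := fun t => by
    ext l x : 2
    exact hpx (t, l) _ (hpV (t, l) x)
  have hloc : IsLocallyConstant fun t => indexBundle (h t) := by
    rw [IsLocallyConstant.iff_eventually_eq]
    intro s
    filter_upwards [eventually_exists_conjugation (𝔸 := C(Λ, X →L[ℝ] X)) hq hqq s] with t ht
    obtain ⟨u, hu, hu'⟩ := ht
    have e1 : ∀ l x, (u : C(Λ, X →L[ℝ] X)) l (p (s, l) x) =
        p (t, l) ((u : C(Λ, X →L[ℝ] X)) l x) := fun l x =>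
      congrArg (fun f : C(Λ, X →L[ℝ] X) => f l x) hu
    have e2 : ∀ l x, p (s, l) ((u⁻¹ : C(Λ, X →L[ℝ] X)ˣ).1 l x) =
        (u⁻¹ : C(Λ, X →L[ℝ] X)ˣ).1 l (p (t, l) x) := fun l x =>
      congrArg (fun f : C(Λ, X →L[ℝ] X) => f l x) hu'
    obtain ⟨φ⟩ := nonempty_kernelBundle_iso (h s) (h t) (hVt s) (hVt t)
      (g := (u : C(Λ, X →L[ℝ] X))) (g' := (u⁻¹ : C(Λ, X →L[ℝ] X)ˣ).1)
      (map_continuous _) (map_continuous _)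
      (fun l x => congrArg (fun f : C(Λ, X →L[ℝ] X) => f l x) u.mul_inv)
      (fun l x => congrArg (fun f : C(Λ, X →L[ℝ] X) => f l x) u.inv_mul)
      (fun l x hx => by
        have h1 := hpV (t, l) ((u : C(Λ, X →L[ℝ] X)) l x)
        rw [← e1, hpx (s, l) x hx] at h1
        exact h1)
      (fun l x hx => by
        have h1 := hpV (s, l) ((u⁻¹ : C(Λ, X →L[ℝ] X)ˣ).1 l x)
        rw [e2, hpx (t, l) x hx] at h1
        exact h1)
    rw [indexBundle_eq (h s) (hVt s), indexBundle_eq (h t) (hVt t)]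
    unfold indexClass KO.of
    rw [RealVectorBundle.cls_eq φ]
  exact hloc.apply_eq_of_preconnectedSpace s t

theorem indexBundle_congr {L L' : Λ → X →L[ℝ] Y} (hL : IsFredholmFamily L)
    (hL' : IsFredholmFamily L') (e : L = L') : indexBundle hL = indexBundle hL' := by
  subst e
  rfl

/-- The index bundle is invariant along affine paths of Fredholm families. -/
theorem indexBundle_eq_of_isFredholm_sub_smul {L L' N : Λ → X →L[ℝ] Y} (hL : Continuous L)
    (hN : Continuous N) (hLN : ∀ l, L' l = L l - N l)
    (hfred : ∀ t ∈ Icc (0 : ℝ) 1, ∀ l, (L l - t • N l).IsFredholm) :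
    ∃ (h' : IsFredholmFamily L') (h : IsFredholmFamily L), indexBundle h' = indexBundle h := by
  let F : unitInterval → Λ → X →L[ℝ] Y := fun t l => L l - (t : ℝ) • N l
  have hF : IsFredholmFamily fun p : unitInterval × Λ => F p.1 p.2 :=
    ⟨by fun_prop, fun p => hfred p.1 p.1.2 p.2⟩
  have h : ∀ t, IsFredholmFamily (F t) := fun t => ⟨by fun_prop, hfred t t.2⟩
  have e0 : F 0 = L := by
    ext l : 1
    simp [F]
  have e1 : F 1 = L' := by
    ext l : 1
    simp [F, hLN]
  have h0 := h 0
  have h1 := h 1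
  rw [e0] at h0
  rw [e1] at h1
  refine ⟨h1, h0, ?_⟩
  rw [← indexBundle_congr (h 1) h1 e1, ← indexBundle_congr (h 0) h0 e0]
  exact indexBundle_eq_of_homotopy hF h 1 0

end Homotopy

/-! ### The affine path from `A` to `A + D`. -/

namespace LinearField

variable {Λ : Type*} [TopologicalSpace Λ] {d : ℕ}

theorem IsDichotomyRadius.isFredholm {A : LinearField Λ d} {γp γm : ℝ}
    (h : A.IsDichotomyRadius γp γm) {D : LinearField Λ d} (hD : D.IsSmallAtInfty γp γm) (l : Λ) :
    ((A + D).operator l).IsFredholm := by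
  obtain ⟨κ, P, -, hP⟩ := h.right D hD
  obtain ⟨κ', Q, -, hQ⟩ := h.left D hD
  exact isFredholm_of_isDichotomy ((A + D).bounded l) (hP l) (hQ l)

/-- Multiplication of a field by a scalar in the unit interval. -/
noncomputable def scale (t : ℝ) (ht : |t| ≤ 1) (D : LinearField Λ d) : LinearField Λ d where
  toFun n l := t • D.toFun n l
  equicontinuous l₀ := by
    rw [Metric.equicontinuousAt_iff_right]
    intro ε hε
    filter_upwards [Metric.equicontinuousAt_iff_right.1 (D.equicontinuous l₀) ε hε] with l hl n
    have h := hl n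
    rw [dist_eq_norm] at h ⊢
    have e : t • D.toFun n l₀ - t • D.toFun n l = t • (D.toFun n l₀ - D.toFun n l) :=
      (smul_sub t _ _).symm
    rw [e, norm_smul, Real.norm_eq_abs]
    exact (mul_le_of_le_one_left (norm_nonneg _) ht).trans_lt h
  bounded l := by
    obtain ⟨C, hC⟩ := D.bounded l
    refine ⟨C, fun n => ?_⟩
    rw [norm_smul, Real.norm_eq_abs]
    exact (mul_le_of_le_one_left (norm_nonneg _) ht).trans (hC n)

theorem IsSmallAtInfty.scale {D : LinearField Λ d} {γp γm : ℝ} (hD : D.IsSmallAtInfty γp γm)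
    {t : ℝ} (ht : |t| ≤ 1) : (D.scale t ht).IsSmallAtInfty γp γm := by
  have h : ∀ n l, ‖(D.scale t ht).toFun n l‖ ≤ ‖D.toFun n l‖ := fun n l => by
    change ‖t • D.toFun n l‖ ≤ _
    rw [norm_smul, Real.norm_eq_abs]
    exact mul_le_of_le_one_left (norm_nonneg _) ht
  obtain ⟨⟨κ, hκ0, hκ⟩, κ', hκ'0, hκ'⟩ := hD
  exact ⟨⟨κ, hκ0, fun n hn l => (h n l).trans (hκ n hn l)⟩,
    κ', hκ'0, fun n hn l => (h n l).trans (hκ' n hn l)⟩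

theorem operator_add (A D : LinearField Λ d) (l : Λ) : (A + D).operator l =
    A.operator l - nemitski (fun n => D.toFun n l) (D.bounded l) := by
  ext φ n : 2
  exact (sub_sub (φ (n + 1)) (A.toFun n l (φ n)) (D.toFun n l (φ n))).symm

theorem nemitski_scale (D : LinearField Λ d) {t : ℝ} (ht : |t| ≤ 1) (l : Λ) :
    nemitski (fun n => (D.scale t ht).toFun n l) ((D.scale t ht).bounded l) =
      t • nemitski (fun n => D.toFun n l) (D.bounded l) := by
  ext φ n : 2
  rfl

end LinearField

theorem mainTheorem7 {Λ : Type*} [MetricSpace Λ] [CompactSpace Λ] [PathConnectedSpace Λ] {d : ℕ}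
    (A : LinearField Λ d) (hA : A.IsAsymptoticallyHyperbolic) :
    (∃ γp γm : ℝ, A.IsDichotomyRadius γp γm) ∧
    ∀ γp γm : ℝ, A.IsDichotomyRadius γp γm →
      ∀ D : LinearField Λ d, D.IsSmallAtInfty γp γm →
        ∃ (hAD : IsFredholmFamily (A + D).operator) (hL : IsFredholmFamily A.operator),
          indexBundle hAD = indexBundle hL := by
  refine ⟨hA.exists_isDichotomyRadius, fun γp γm hγ D hD => ?_⟩
  refine indexBundle_eq_of_isFredholm_sub_smul A.continuous_operator D.continuous_nemitski
    (A.operator_add D) fun t ht l => ?_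
  have ht' : |t| ≤ 1 := abs_le.2 ⟨by linarith [ht.1], ht.2⟩
  -- Admissibility is applied to `t • D`, for each `t`, and not only to `D`.
  have h := hγ.isFredholm (hD.scale ht') l
  rwa [LinearField.operator_add, LinearField.nemitski_scale] at h
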